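/- Let $Y=\{f=0\}\subset\mathbb P^5$ be a smooth cubic hypersurface over $\mathbb C$, and let $\mathbb G$ denote the Grassmannian of $3$-dimensional linear subspaces $\mathbb P(W)\subset\mathbb P^5$, i.e. of four-dimensional quotients $\mathbb C^6\to W$ of the space of linear forms. (1) The Zariski closure in $\mathbb G$ of the set of points $[\mathbb P(W)]\in\mathbb G$ such that the scheme-theoretic intersection $S=\mathbb P(W)\cap Y$ is a non-normal integral surface has dimension at most $4$. (2) If moreover $Y$ contains no plane, then the Zariski closure in $\mathbb G$ of the set of points $[\mathbb P(W)]\in\mathbb G$ such that $S=\mathbb P(W)\cap Y$ has a simple-elliptic singularity, i.e. such that $S$ is a cone in $\mathbb P(W)$ over a smooth plane cubic curve, has dimension at most $4$. (The dimension of the empty set is $-\infty$.) -/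

import Mathlib

open scoped Module.Grassmannian

namespace CubicFourfold

/-- The homogeneous form `f` in the variables `σ` is a cubic form whose zero scheme in the
projective space with homogeneous coordinates `σ` is smooth over `ℂ` (projective Jacobian
criterion: `f` and its partial derivatives have no common zero other than the origin).
This fails for `f = 0` as soon as `σ` is non-empty. -/
structure IsSmoothCubic {σ : Type*} (f : MvPolynomial σ ℂ) : Prop where
  homogeneous : f.IsHomogeneous 3
  smooth : ∀ v : σ → ℂ, v ≠ 0 → MvPolynomial.eval v f = 0 →
    ∃ i, MvPolynomial.eval v (MvPolynomial.pderiv i f) ≠ 0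

/-- The hypersurface `{f = 0} ⊂ ℙ⁵` contains a plane, i.e. `f` vanishes on some three-dimensional
linear subspace of `ℂ⁶`. -/
def ContainsPlane (f : MvPolynomial (Fin 6) ℂ) : Prop :=
  ∃ P : Submodule ℂ (Fin 6 → ℂ), Module.finrank ℂ P = 3 ∧ ∀ v ∈ P, MvPolynomial.eval v f = 0

/-- The linear form `a₀ x₀ + ⋯ + a₅ x₅`. -/
noncomputable def linearForm (a : Fin 6 → ℂ) : MvPolynomial (Fin 6) ℂ :=
  ∑ i, MvPolynomial.C (a i) * MvPolynomial.X i

/-- The closed points of the Grassmannian of `3`-spaces `ℙ(W) ⊂ ℙ⁵`. Reading an element of `ℂ⁶` as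
a linear form on `ℙ⁵`, a point is the kernel `N` of an epimorphism `ℂ⁶ → W` onto a
four-dimensional space; the `3`-space `ℙ(W)` is the common zero locus of the linear forms in `N`. -/
abbrev Grass : Type := G(4, (Fin 6 → ℂ); ℂ)

/-- The variety of epimorphisms `ℂ⁶ → ℂ⁴`, written as `4 × 6` matrices. -/
abbrev Frame : Type := {A : Matrix (Fin 4) (Fin 6) ℂ // Function.Surjective A.mulVecLin}

/-- The point of the Grassmannian represented by an epimorphism `ℂ⁶ → ℂ⁴`. -/
noncomputable def Frame.toGrass (A : Frame) : Grass where
  toSubmodule := LinearMap.ker A.1.mulVecLin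
  finite_quotient := inferInstance
  projective_quotient := inferInstance
  rankAtStalk_eq p := by
    have e := A.1.mulVecLin.quotKerEquivOfSurjective A.2
    rw [Module.rankAtStalk_eq_of_equiv e]
    simp [Module.rankAtStalk_eq_finrank_of_free]

/-- The Zariski topology on the quasi-affine variety `Frame ⊂ 𝔸²⁴`: it is induced from the prime
spectrum of the polynomial ring in the `24` matrix entries. -/
noncomputable abbrev Frame.zariski : TopologicalSpace Frame :=
  TopologicalSpace.induced
    (fun A => MvPolynomial.pointToPoint (k := ℂ) (fun ij : Fin 4 × Fin 6 => A.1 ij.1 ij.2))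
    (inferInstance : TopologicalSpace (PrimeSpectrum (MvPolynomial (Fin 4 × Fin 6) ℂ)))

/-- The Zariski topology on the Grassmannian. The Grassmannian is the quotient of `Frame` by the
action of `GL₄`, hence its Zariski topology is the quotient of the one on `Frame`. -/
noncomputable instance : TopologicalSpace Grass :=
  TopologicalSpace.coinduced Frame.toGrass Frame.zariski

/-- A set of `3`-spaces is Zariski closed iff it is given by polynomial equations in the entries
of the matrices that represent its points. -/
theorem isClosed_grass_iff (Z : Set Grass) :
    IsClosed Z ↔ ∃ E : Set (MvPolynomial (Fin 4 × Fin 6) ℂ), ∀ A : Frame,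
      A.toGrass ∈ Z ↔ ∀ p ∈ E, MvPolynomial.eval (fun ij => A.1 ij.1 ij.2) p = 0 := by
  rw [isClosed_coinduced, isClosed_induced_iff]
  have key (A : Frame) (E : Set (MvPolynomial (Fin 4 × Fin 6) ℂ)) :
      MvPolynomial.pointToPoint (k := ℂ) (fun ij : Fin 4 × Fin 6 => A.1 ij.1 ij.2) ∈
        PrimeSpectrum.zeroLocus E ↔
      ∀ p ∈ E, MvPolynomial.eval (fun ij => A.1 ij.1 ij.2) p = 0 := by
    simp only [PrimeSpectrum.mem_zeroLocus, MvPolynomial.pointToPoint, Set.subset_def,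
      SetLike.mem_coe, MvPolynomial.mem_vanishingIdeal_singleton_iff]
    rfl
  constructor
  · rintro ⟨t, ht, h⟩
    obtain ⟨E, rfl⟩ := (PrimeSpectrum.isClosed_iff_zeroLocus _).1 ht
    refine ⟨E, fun A => ?_⟩
    rw [← key, ← Set.mem_preimage, ← h]
    rfl
  · rintro ⟨E, h⟩
    refine ⟨PrimeSpectrum.zeroLocus E, PrimeSpectrum.isClosed_zeroLocus _, ?_⟩
    ext A
    exact (key A E).trans (h A).symm

/-- The homogeneous ideal of `ℂ[x₀, …, x₅]` that defines the scheme-theoretic intersection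
`S = ℙ(W) ∩ {f = 0}`, for the `3`-space `ℙ(W)` given by `N`. -/
noncomputable def sectionIdeal (f : MvPolynomial (Fin 6) ℂ) (N : Grass) :
    Ideal (MvPolynomial (Fin 6) ℂ) :=
  Ideal.span (insert f (linearForm '' (N.toSubmodule : Set (Fin 6 → ℂ))))

/-- The section `S = ℙ(W) ∩ {f = 0}` is integral: its homogeneous ideal is prime. Equivalently the
cubic form induced by `f` on the `3`-space is irreducible (or zero, which does not happen for a
smooth cubic fourfold). -/
def IsIntegralSection (f : MvPolynomial (Fin 6) ℂ) (N : Grass) : Prop :=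
  (sectionIdeal f N).IsPrime

/-- The coordinate ring `ℂ[x₀, …, x₅] / (I, xᵢ - 1)` of the affine open part `xᵢ ≠ 0` of the
section `S`, where `I` is the homogeneous ideal of `S`. -/
abbrev ChartRing (f : MvPolynomial (Fin 6) ℂ) (N : Grass) (i : Fin 6) : Type :=
  MvPolynomial (Fin 6) ℂ ⧸ (sectionIdeal f N ⊔ Ideal.span {MvPolynomial.X i - 1})

/-- The section `S = ℙ(W) ∩ {f = 0}` is a normal scheme: all its local rings are integrally closed
domains. -/
def IsNormalSection (f : MvPolynomial (Fin 6) ℂ) (N : Grass) : Prop :=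
  ∀ (i : Fin 6) (p : Ideal (ChartRing f N i)) [p.IsPrime],
    IsDomain (Localization.AtPrime p) ∧ IsIntegrallyClosed (Localization.AtPrime p)

/-- The section `S = ℙ(W) ∩ {f = 0}` has a simple-elliptic singularity: it is the cone, in
`ℙ(W)`, over a smooth plane cubic curve `{h = 0}`. Here `y₀, y₁, y₂` are linear forms that are
linearly independent on `ℙ(W)` (the vertex is their common zero), and `S` is defined in `ℙ(W)` by
`h(y₀, y₁, y₂)`. -/
def IsSimpleEllipticSection (f : MvPolynomial (Fin 6) ℂ) (N : Grass) : Prop :=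
  ∃ (y : Fin 3 → (Fin 6 → ℂ)) (h : MvPolynomial (Fin 3) ℂ),
    LinearIndependent ℂ (fun j => N.toSubmodule.mkQ (y j)) ∧ IsSmoothCubic h ∧
    sectionIdeal f N = sectionIdeal (MvPolynomial.aeval (fun j => linearForm (y j)) h) N

end CubicFourfold

/-! ### Derivations and the dimension of a projection -/

section
open MvPolynomial TensorProduct

/-! Dimensions are bounded by counting derivations. For a point `w` of an affine chart of the
Grassmannian with values in a field `K` over `ℂ`, the dimension of its closure over `ℂ` is at most
the `K`-dimension of the space of velocities `D w`, where `D` runs over the derivations of `K`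
(`ringKrullDim_quotient_le_finrank`). A bad section carries extra data, a vertex or a double line,
so the bad locus is covered by projections of finitely many incidence varieties. By
`ringKrullDim_quotient_le_of_forall_point` and `topologicalKrullDim_closure_le` it is enough that
every `K`-point of such a variety has at most four dimensions of velocities. These are found by
differentiating equations in the symmetric trilinear form `F` of `f`; write `W` for the four-space
of the section.

Double line spanned by `p`, `q` (`finrank_line_le`): the forms `F p p`, `F p q`, `F q q` vanish on
`W`. Smoothness makes the binary quadrics `s² F p p v + 2st F p q v + t² F q q v` base point free.
Hence the velocity of `W` is determined by those of `p` and `q`, and these lie in the tangent space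
of the variety of lines on the cubic, of dimension `12 - 8 = 4`.

Cone with vertex `p` (`finrank_cone_le`): `F p` vanishes on `W × W`. If `F p` is nonzero on the
tangent hyperplane `ker (F p p)`, then `W` is rigid once `p` is fixed, and `p` moves on a fourfold.
Otherwise `p` is an Eckardt point, which cannot move, and `W` moves inside a fixed hyperplane, which
leaves four parameters.

For a cone over a plane cubic the equations come from `exists_vertex`. For a non-normal integral
section one shows that finitely many singular points in a chart would force normality there, a
concrete form of Serre's criterion: derivatives of the cubic conduct the integral closure
(`exists_algebraMap_eq_derivative_mul`), and freeness over a polynomial ring in two variables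
supplies depth two (`exists_algebraMap_eq_of_isRelPrime`). So there are infinitely many singular
points, and among any five of them two span a double line (`exists_line_of_five`). -/

/-- Formal étaleness identifies the differentials of `K` with the base change of those of `P`, so
the linear form attached to `d` transports to `K`. -/
theorem exists_derivation_extending {k P K : Type*} [CommRing k] [CommRing P] [CommRing K]
    [Algebra k P] [Algebra k K] [Algebra P K] [IsScalarTower k P K] [Algebra.FormallyEtale P K]
    (d : Derivation k P K) : ∃ D : Derivation k K K, ∀ x, D (algebraMap P K x) = d x := by
  let L : K ⊗[P] Ω[P⁄k] →ₗ[K] K := LinearMap.liftBaseChange K d.liftKaehlerDifferential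
  refine ⟨(L ∘ₗ (KaehlerDifferential.tensorKaehlerEquivOfFormallyEtale k P K).symm.toLinearMap).compDer
    (KaehlerDifferential.D k K), fun x => ?_⟩
  change L ((KaehlerDifferential.tensorKaehlerEquivOfFormallyEtale k P K).symm
    (KaehlerDifferential.D k K (algebraMap P K x))) = d x
  rw [KaehlerDifferential.tensorKaehlerEquivOfFormallyEtale_symm_D_algebraMap]
  simp [L]

theorem formallyEtale_of_isAlgebraic (P K : Type*) [CommRing P] [IsDomain P] [CharZero P] [Field K]
    [Algebra P K] [FaithfulSMul P K] [Algebra.IsAlgebraic P K] : Algebra.FormallyEtale P K := by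
  let := FractionRing.liftAlgebra P K
  have : IsScalarTower P (FractionRing P) K := FractionRing.isScalarTower_liftAlgebra P K
  have : Algebra.IsAlgebraic (FractionRing P) K :=
    (IsFractionRing.comap_isAlgebraic_iff (A := P) (K := FractionRing P) (C := K)).1 inferInstance
  have : CharZero (FractionRing P) :=
    charZero_of_injective_algebraMap (IsFractionRing.injective P (FractionRing P))
  have : Algebra.FormallyEtale (FractionRing P) K := Algebra.FormallyEtale.of_isSeparable _ K
  have : Algebra.FormallyEtale P (FractionRing P) :=
    Algebra.FormallyEtale.of_isLocalization (nonZeroDivisors P)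
  exact Algebra.FormallyEtale.comp P (FractionRing P) K

/-- Extend the family to a transcendence basis. A polynomial ring has derivations with arbitrary
values on the variables, and `K` is algebraic, hence formally étale, over it. -/
theorem exists_derivation_apply_eq {k K : Type*} [Field k] [CharZero k] [Field K] [Algebra k K]
    {ι : Type*} {t : ι → K} (ht : AlgebraicIndependent k t) (c : ι → K) :
    ∃ D : Derivation k K K, ∀ i, D (t i) = c i := by
  obtain ⟨s, hts, hs⟩ := exists_isTranscendenceBasis_superset ht.coe_range
  let := (aeval (R := k) (Subtype.val : s → K)).toRingHom.toAlgebra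
  have hval : ∀ p : MvPolynomial s k, algebraMap _ K p = aeval (Subtype.val : s → K) p :=
    fun _ => rfl
  have : IsScalarTower k (MvPolynomial s k) K := IsScalarTower.of_algebraMap_eq fun x => by
    rw [hval]; exact ((aeval (R := k) (Subtype.val : s → K)).commutes x).symm
  have : FaithfulSMul (MvPolynomial s k) K := (faithfulSMul_iff_algebraMap_injective _ K).2 hs.1
  have : Algebra.IsAlgebraic (MvPolynomial s k) K := by
    have := hs.isAlgebraic
    refine Algebra.IsAlgebraic.of_ringHom_of_comp_eq
      (S := Algebra.adjoin k (Set.range (Subtype.val : s → K))) (B := K)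
      (hs.1.aevalEquiv : MvPolynomial s k →+* _) (RingHom.id K)
      hs.1.aevalEquiv.surjective Function.injective_id ?_
    ext p
    · simp [hval]
    · simp [hval]
  have := formallyEtale_of_isAlgebraic (MvPolynomial s k) K
  classical
  obtain ⟨D, hD⟩ := exists_derivation_extending
    -- Basis elements outside the given family may take any value; zero is chosen.
    (mkDerivation k fun x : s => if h : ∃ i, t i = x then c h.choose else 0)
  refine ⟨D, fun i => ?_⟩
  have h2 : ∃ j, t j = ((⟨t i, hts ⟨i, rfl⟩⟩ : s) : K) := ⟨i, rfl⟩
  have hi := hD (X ⟨t i, hts ⟨i, rfl⟩⟩)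
  rw [hval, aeval_X, mkDerivation_X, dif_pos h2, ht.injective h2.choose_spec] at hi
  exact hi

theorem ringKrullDim_le_of_isIntegral (R S : Type*) [CommRing R] [CommRing S] [Algebra R S]
    [Algebra.IsIntegral R S] : ringKrullDim S ≤ ringKrullDim R :=
  Order.krullDim_le_of_strictMono (PrimeSpectrum.comap (algebraMap R S)) fun _ _ h =>
    Ideal.IsIntegral.comap_lt_comap h

section
variable {K : Type} [Field K] [Algebra ℂ K] {σ : Type} [Fintype σ]

/-- The values on `w` of the derivations of `K`. -/
noncomputable def derivationEval (w : σ → K) : Derivation ℂ K K →ₗ[K] (σ → K) :=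
  LinearMap.pi fun i => 
    { toFun := fun D => D (w i), map_add' := fun _ _ => rfl, map_smul' := fun _ _ => rfl }

omit [Fintype σ] in
@[simp] theorem derivationEval_apply (w : σ → K) (D : Derivation ℂ K K) (i : σ) :
    derivationEval w D i = D (w i) := rfl

theorem derivation_aeval (D : Derivation ℂ K K) (w : σ → K) (p : MvPolynomial σ ℂ) :
    D (aeval w p) = ∑ i, aeval w (pderiv i p) * D (w i) := by
  induction p using MvPolynomial.induction_on with
  | C a => simp
  | add p q hp hq => simp [hp, hq, add_mul, Finset.sum_add_distrib]
  | mul_X p i hp => 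
    classical
    simp [hp, pderiv_X, Pi.single_apply, add_mul, Finset.sum_add_distrib, Finset.mul_sum]
    simp [apply_ite, ite_mul]
    ring_nf

/-- Noether normalization: the variables stay independent in `K`, and integrality bounds the
dimension by their number. -/
theorem exists_isIntegral_aeval (R : Type) [CommRing R] [Algebra ℂ R] [Algebra.FiniteType ℂ R]
    (ψ : R →ₐ[ℂ] K) (hψ : Function.Injective ψ) : ∃ (n : ℕ) (r : Fin n → R),
      ringKrullDim R ≤ n ∧ AlgebraicIndependent ℂ fun i => ψ (r i) := by
  have : Nontrivial R := ψ.toRingHom.domain_nontrivial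
  obtain ⟨n, g, hg, hgi⟩ := exists_integral_inj_algHom_of_fg ℂ R
  refine ⟨n, fun i => g (X i), ?_, ?_⟩
  · let := g.toRingHom.toAlgebra
    have : Algebra.IsIntegral (MvPolynomial (Fin n) ℂ) R := ⟨hgi⟩
    simpa using ringKrullDim_le_of_isIntegral (MvPolynomial (Fin n) ℂ) R
  · have : (aeval (fun i => ψ (g (X i))) : MvPolynomial (Fin n) ℂ →ₐ[ℂ] K) = ψ.comp g := by
      ext i; simp
    rw [AlgebraicIndependent, this]
    exact hψ.comp hg

/-- By the chain rule the derivatives of polynomials in `w` depend linearly on the velocity of `w`.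
On `n` algebraically independent polynomials these derivatives can be prescribed, so the space of
velocities maps onto `K ^ n`. -/
theorem ringKrullDim_quotient_le_finrank (w : σ → K) :
    ringKrullDim (MvPolynomial σ ℂ ⧸ RingHom.ker (aeval (R := ℂ) w)) ≤
      (Module.finrank K (LinearMap.range (derivationEval w)) : ℕ) := by
  obtain ⟨n, r, hdim, ht⟩ := exists_isIntegral_aeval _
    (Ideal.kerLiftAlg (aeval (R := ℂ) w)) (Ideal.kerLiftAlg_injective _)
  refine hdim.trans (Nat.cast_le.2 ?_)
  choose p hp using fun i => Ideal.Quotient.mk_surjective (r i)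
  have hp' : ∀ i, Ideal.kerLiftAlg (aeval (R := ℂ) w) (r i) = aeval w (p i) := fun i => by
    rw [← hp]; rfl
  simp only [hp'] at ht
  let T : (σ → K) →ₗ[K] (Fin n → K) := LinearMap.pi fun i =>
    ∑ j, aeval w (pderiv j (p i)) • LinearMap.proj j
  have hT : (T ∘ₗ (derivationEval w).range.subtype).range = ⊤ := by
    refine LinearMap.range_eq_top.2 fun c => ?_
    obtain ⟨D, hD⟩ := exists_derivation_apply_eq ht c
    refine ⟨⟨derivationEval w D, D, rfl⟩, ?_⟩
    ext i
    simp [T, ← hD, derivation_aeval]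
  have := LinearMap.finrank_range_le (T ∘ₗ (derivationEval w).range.subtype)
  rw [hT] at this
  simpa using this

theorem exists_algHom_ker_eq {R : Type} [CommRing R] [Algebra ℂ R] (Q : Ideal R) [Q.IsPrime] :
    ∃ (K : Type) (_ : Field K) (_ : Algebra ℂ K) (_ : IsAlgClosed K) (z : R →ₐ[ℂ] K),
      RingHom.ker z = Q := by
  refine ⟨AlgebraicClosure (FractionRing (R ⧸ Q)), inferInstance, inferInstance, inferInstance,
    (IsScalarTower.toAlgHom ℂ (R ⧸ Q) _).comp (Ideal.Quotient.mkₐ ℂ Q), ?_⟩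
  ext x
  change algebraMap (R ⧸ Q) (AlgebraicClosure (FractionRing (R ⧸ Q))) (Ideal.Quotient.mk Q x) = 0 ↔ _
  rw [IsScalarTower.algebraMap_apply (R ⧸ Q) (FractionRing (R ⧸ Q)), map_eq_zero,
    map_eq_zero_iff _ (IsFractionRing.injective (R ⧸ Q) (FractionRing (R ⧸ Q))),
    Ideal.Quotient.eq_zero_iff_mem]

omit [Field K] [Algebra ℂ K] in
/-- A family of generic points controls the dimension of the closure of a projection. -/
theorem ringKrullDim_quotient_le_of_forall_point {τ κ : Type} [Fintype τ] [Finite κ] {d : ℕ}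
    (S : Set (σ → ℂ)) (E : κ → Set (MvPolynomial (σ ⊕ τ) ℂ))
    (hX : ∀ x ∈ S, ∃ k y, ∀ p ∈ E k, aeval (Sum.elim x y) p = 0)
    (hE : ∀ (K : Type) [Field K] [Algebra ℂ K] [IsAlgClosed K] (k : κ) (x : σ → K) (y : τ → K),
      (∀ p ∈ E k, aeval (Sum.elim x y) p = 0) →
        Module.finrank K (LinearMap.range (derivationEval x)) ≤ d)
    (P : Ideal (MvPolynomial σ ℂ)) [P.IsPrime]
    (hP : ∀ p : MvPolynomial σ ℂ, (∀ x ∈ S, eval x p = 0) → p ∈ P) :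
    ringKrullDim (MvPolynomial σ ℂ ⧸ P) ≤ d := by
  let φ : MvPolynomial σ ℂ →ₐ[ℂ] MvPolynomial (σ ⊕ τ) ℂ := rename Sum.inl
  let M : Set (Ideal (MvPolynomial (σ ⊕ τ) ℂ)) := ⋃ k, (Ideal.span (E k)).minimalPrimes
  have hM : M.Finite := Set.finite_iUnion fun k => Ideal.finite_minimalPrimes_of_isNoetherianRing _ _
  have hle : hM.toFinset.inf (fun Q => Q.comap φ) ≤ P := by
    intro p hp
    refine hP p fun x hx => ?_
    obtain ⟨k, y, hy⟩ := hX x hx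
    have hk : Ideal.span (E k) ≤ RingHom.ker (aeval (R := ℂ) (Sum.elim x y)) :=
      Ideal.span_le.2 hy
    have := RingHom.ker_isPrime (aeval (R := ℂ) (Sum.elim x y))
    obtain ⟨Q, hQ, hQle⟩ := Ideal.exists_minimalPrimes_le hk
    have : p ∈ Q.comap φ := by
      have := Finset.inf_le (f := fun Q : Ideal _ => Q.comap φ)
        (hM.mem_toFinset.2 (Set.mem_iUnion.2 ⟨k, hQ⟩))
      exact this hp
    have := hQle this
    simpa [φ, RingHom.mem_ker, aeval_rename, coe_aeval_eq_eval] using this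
  -- A prime containing a finite intersection contains one of its members, so a single component of
  -- one incidence variety dominates `P`. Its generic point is the `K`-point to which `hE` applies.
  obtain ⟨Q, hQM, hQP⟩ := (Ideal.IsPrime.inf_le' inferInstance).1 hle
  obtain ⟨k, hQ⟩ := Set.mem_iUnion.1 (hM.mem_toFinset.1 hQM)
  have hQp : Q.IsPrime := hQ.1.1
  obtain ⟨K, _, _, _, z, hz⟩ := exists_algHom_ker_eq Q
  let x : σ → K := fun i => z (X (Sum.inl i))
  let y : τ → K := fun i => z (X (Sum.inr i))
  have hzz : aeval (Sum.elim x y) = z := by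
    ext i; cases i <;> simp [x, y]
  have hfin := hE K k x y fun p hp => by
    rw [hzz]
    have : p ∈ RingHom.ker z := hz ▸ hQ.1.2 (Ideal.subset_span hp)
    exact this
  have hker : RingHom.ker (aeval (R := ℂ) x) ≤ P := fun p hp => hQP <| by
    have h1 : aeval (R := ℂ) x = z.comp φ := by ext i; simp [x, φ]
    rw [Ideal.mem_comap, ← hz]
    rw [h1] at hp
    exact hp
  calc ringKrullDim (MvPolynomial σ ℂ ⧸ P)
      ≤ ringKrullDim (MvPolynomial σ ℂ ⧸ RingHom.ker (aeval (R := ℂ) x)) :=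
        ringKrullDim_le_of_surjective (Ideal.Quotient.factor hker)
          (Ideal.Quotient.factor_surjective hker)
    _ ≤ _ := (ringKrullDim_quotient_le_finrank x).trans (Nat.cast_le.2 hfin)
end
end

/-! ### Affine charts and the Zariski topology of the Grassmannian -/

namespace CubicFourfold
open Matrix

/-- The matrix `(1 | w)` with columns permuted by `e`. -/
def chartMatrix {R : Type*} [Zero R] [One R] (e : Fin 4 ⊕ Fin 2 ≃ Fin 6) (w : Fin 4 × Fin 2 → R) :
    Matrix (Fin 4) (Fin 6) R :=
  Matrix.of fun i j => Sum.elim (fun k => if i = k then 1 else 0) (fun l => w (i, l)) (e.symm j)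

section
variable {R : Type*} [Zero R] [One R] (e : Fin 4 ⊕ Fin 2 ≃ Fin 6) (w : Fin 4 × Fin 2 → R)

@[simp] theorem chartMatrix_inl (i k : Fin 4) :
    chartMatrix e w i (e (Sum.inl k)) = if i = k then 1 else 0 := by simp [chartMatrix]

@[simp] theorem chartMatrix_inr (i : Fin 4) (l : Fin 2) :
    chartMatrix e w i (e (Sum.inr l)) = w (i, l) := by simp [chartMatrix]
end

theorem sum_fin_six {M : Type*} [AddCommMonoid M] (e : Fin 4 ⊕ Fin 2 ≃ Fin 6) (g : Fin 6 → M) :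
    ∑ j, g j = ∑ k, g (e (Sum.inl k)) + ∑ l, g (e (Sum.inr l)) := by
  rw [← e.sum_comp, Fintype.sum_sum_type]

/-- The affine chart of the Grassmannian given by `e`, lifted to frames. -/
noncomputable def chartFrame (e : Fin 4 ⊕ Fin 2 ≃ Fin 6) (w : Fin 4 × Fin 2 → ℂ) : Frame :=
  ⟨chartMatrix e w, fun y => ⟨fun j => Sum.elim y 0 (e.symm j), by
    ext i
    simp [mulVec, dotProduct, sum_fin_six e]⟩⟩

theorem Frame.toGrass_eq_iff (A B : Frame) :
    A.toGrass = B.toGrass ↔ ∃ g : Matrix (Fin 4) (Fin 4) ℂ, IsUnit g.det ∧ B.1 = g * A.1 := by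
  constructor
  · intro h
    have hker : LinearMap.ker A.1.mulVecLin = LinearMap.ker B.1.mulVecLin :=
      congrArg (fun N : Grass => N.toSubmodule) h
    obtain ⟨C, hC⟩ := Matrix.mulVec_surjective_iff_exists_right_inverse.1 A.2
    have hB : B.1 = (B.1 * C) * A.1 := by
      refine Matrix.ext_of_mulVec_single fun j => ?_
      have : Pi.single j 1 - (C * A.1) *ᵥ Pi.single j 1 ∈ LinearMap.ker B.1.mulVecLin := by
        rw [← hker, LinearMap.mem_ker, mulVecLin_apply, mulVec_sub, mulVec_mulVec,
          ← Matrix.mul_assoc, hC, Matrix.one_mul, sub_self]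
      rw [LinearMap.mem_ker, mulVecLin_apply, mulVec_sub, mulVec_mulVec, sub_eq_zero] at this
      rw [this, Matrix.mul_assoc]
    refine ⟨B.1 * C, ?_, hB⟩
    rw [← Matrix.isUnit_iff_isUnit_det, ← Matrix.mulVec_surjective_iff_isUnit]
    intro y
    obtain ⟨x, hx⟩ := B.2 y
    refine ⟨A.1 *ᵥ x, ?_⟩
    rw [mulVec_mulVec, ← hB]
    exact hx
  · rintro ⟨g, hg, hB⟩
    refine Module.Grassmannian.ext ?_
    change LinearMap.ker A.1.mulVecLin = LinearMap.ker B.1.mulVecLin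
    have hinj := Matrix.mulVec_injective_iff_isUnit.2 ((Matrix.isUnit_iff_isUnit_det g).2 hg)
    ext x
    rw [LinearMap.mem_ker, LinearMap.mem_ker, mulVecLin_apply, mulVecLin_apply, hB,
      ← mulVec_mulVec]
    exact ⟨fun h => by rw [h, mulVec_zero], fun h => hinj (by rw [h, mulVec_zero])⟩

theorem finrank_quotient_grass (N : Grass) :
    Module.finrank ℂ ((Fin 6 → ℂ) ⧸ N.toSubmodule) = 4 := by
  have := N.rankAtStalk_eq ⟨⊥, Ideal.isPrime_bot⟩
  rwa [Module.rankAtStalk_eq_finrank_of_free] at this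

theorem exists_frame (N : Grass) : ∃ A : Frame, A.toGrass = N := by
  let q : ((Fin 6 → ℂ) ⧸ N.toSubmodule) ≃ₗ[ℂ] (Fin 4 → ℂ) :=
    LinearEquiv.ofFinrankEq _ _ (by rw [finrank_quotient_grass, Module.finrank_fin_fun])
  let φ : (Fin 6 → ℂ) →ₗ[ℂ] (Fin 4 → ℂ) := q.toLinearMap ∘ₗ N.toSubmodule.mkQ
  have hφ : (LinearMap.toMatrix' φ).mulVecLin = φ := Matrix.toLin'_toMatrix' φ
  refine ⟨⟨LinearMap.toMatrix' φ, ?_⟩, Module.Grassmannian.ext ?_⟩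
  · rw [hφ]
    exact q.surjective.comp N.toSubmodule.mkQ_surjective
  · change LinearMap.ker (LinearMap.toMatrix' φ).mulVecLin = _
    rw [hφ, LinearEquiv.ker_comp, Submodule.ker_mkQ]

theorem chartFrame_toGrass_eq_iff (e : Fin 4 ⊕ Fin 2 ≃ Fin 6) (w : Fin 4 × Fin 2 → ℂ) (A : Frame) :
    (chartFrame e w).toGrass = A.toGrass ↔
      IsUnit (A.1.submatrix id (e ∘ Sum.inl)).det ∧
        A.1.submatrix id (e ∘ Sum.inr) =
          A.1.submatrix id (e ∘ Sum.inl) * Matrix.of fun i j => w (i, j) := by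
  rw [Frame.toGrass_eq_iff]
  constructor
  · rintro ⟨g, hg, hA⟩
    have h1 : A.1.submatrix id (e ∘ Sum.inl) = g := by
      ext i j
      simp [hA, chartFrame, Matrix.mul_apply]
    rw [h1]
    refine ⟨hg, ?_⟩
    ext i j
    simp [hA, chartFrame, Matrix.mul_apply]
  · rintro ⟨hd, h⟩
    refine ⟨_, hd, ?_⟩
    ext i j
    obtain ⟨k | l, rfl⟩ := e.surjective j
    · simp [chartFrame, Matrix.mul_apply]
    · have := congrFun (congrFun h i) l
      simpa [chartFrame, Matrix.mul_apply] using this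

theorem exists_chart (N : Grass) : ∃ e w, (chartFrame e w).toGrass = N := by
  obtain ⟨A, rfl⟩ := exists_frame N
  obtain ⟨κ, a, ha, hspan, hli⟩ := exists_linearIndependent' ℂ A.1.col
  have htop : Submodule.span ℂ (Set.range A.1.col) = ⊤ := by
    rw [← Matrix.range_mulVecLin]
    exact LinearMap.range_eq_top.2 A.2
  rw [htop] at hspan
  have : Finite κ := Finite.of_injective a ha
  have : Fintype κ := Fintype.ofFinite κ
  let b := Module.Basis.mk hli hspan.ge
  have hcard : Fintype.card κ = 4 := by
    rw [← Module.finrank_eq_card_basis b, Module.finrank_fin_fun]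
  let ε : Fin 4 ≃ κ := (Fintype.equivFinOfCardEq hcard).symm
  have hc : Function.Injective (a ∘ ε) := ha.comp ε.injective
  classical
  have hcard' : Fintype.card ↥(Set.range (a ∘ ε))ᶜ = 2 := by
    rw [Fintype.card_compl_set, Set.card_range_of_injective hc]
    simp
  let e : Fin 4 ⊕ Fin 2 ≃ Fin 6 :=
    (Equiv.sumCongr (Equiv.ofInjective _ hc) (Fintype.equivFinOfCardEq hcard').symm).trans
      (Equiv.Set.sumCompl _)
  have he : e ∘ Sum.inl = a ∘ ε := by
    ext i
    simp [e]
  have hu : IsUnit (A.1.submatrix id (e ∘ Sum.inl)) := by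
    rw [← Matrix.linearIndependent_cols_iff_isUnit, he]
    exact hli.comp ε ε.injective
  refine ⟨e, fun ij => ((A.1.submatrix id (e ∘ Sum.inl))⁻¹ * A.1.submatrix id (e ∘ Sum.inr)) ij.1 ij.2,
    (chartFrame_toGrass_eq_iff _ _ _).2 ⟨(Matrix.isUnit_iff_isUnit_det _).1 hu, ?_⟩⟩
  have : (Matrix.of fun i j => ((A.1.submatrix id (e ∘ Sum.inl))⁻¹ *
      A.1.submatrix id (e ∘ Sum.inr)) i j) =
      (A.1.submatrix id (e ∘ Sum.inl))⁻¹ * A.1.submatrix id (e ∘ Sum.inr) := rfl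
  rw [this, ← Matrix.mul_assoc, Matrix.mul_nonsing_inv _ ((Matrix.isUnit_iff_isUnit_det _).1 hu),
    Matrix.one_mul]

theorem eval_smul_of_isHomogeneous {σ R : Type*} [CommRing R] {p : MvPolynomial σ R} {n : ℕ}
    (hp : p.IsHomogeneous n) (c : R) (x : σ → R) :
    MvPolynomial.eval (c • x) p = c ^ n * MvPolynomial.eval x p := by
  rw [MvPolynomial.eval_eq, MvPolynomial.eval_eq, Finset.mul_sum]
  refine Finset.sum_congr rfl fun d hd => ?_
  have : c ^ n = ∏ i ∈ d.support, c ^ d i := by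
    rw [Finset.prod_pow_eq_pow_sum]
    congr 1
    rw [hp.degree_eq_sum_deg_support hd]
  rw [this]
  simp only [Pi.smul_apply, smul_eq_mul, mul_pow, Finset.prod_mul_distrib]
  ring

/-- On the chart, `w` is the inverse of a `4 × 4` block times the other block. Replacing the inverse
by the adjugate scales `w` by the determinant, and each homogeneous component of `p` is then
weighted by the missing power of it. -/
theorem isClosed_chart (e : Fin 4 ⊕ Fin 2 ≃ Fin 6) (p : MvPolynomial (Fin 4 × Fin 2) ℂ) :
    IsClosed {N : Grass | ∀ w, (chartFrame e w).toGrass = N → MvPolynomial.eval w p = 0} := by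
  let G : Matrix (Fin 4) (Fin 6) (MvPolynomial (Fin 4 × Fin 6) ℂ) :=
    Matrix.of fun i j => MvPolynomial.X (i, j)
  let Gs := G.submatrix id (e ∘ Sum.inl)
  let H := Gs.adjugate * G.submatrix id (e ∘ Sum.inr)
  let n := p.totalDegree
  -- The extra determinant factor makes the equation hold off the chart, where the condition is
  -- vacuous.
  let P := Gs.det * ∑ d ∈ Finset.range (n + 1), Gs.det ^ (n - d) *
    MvPolynomial.aeval (fun ij : Fin 4 × Fin 2 => H ij.1 ij.2) (MvPolynomial.homogeneousComponent d p)
  refine (isClosed_grass_iff _).2 ⟨{P}, fun A => ?_⟩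
  let ev := MvPolynomial.eval fun ij : Fin 4 × Fin 6 => A.1 ij.1 ij.2
  let As := A.1.submatrix id (e ∘ Sum.inl)
  have hG : Gs.map ev = As := by ext i j; simp [Gs, G, As, ev]
  have hdet : ev Gs.det = As.det := by rw [RingHom.map_det, RingHom.mapMatrix_apply, hG]
  have hH : ∀ i j, ev (H i j) = (As.adjugate * A.1.submatrix id (e ∘ Sum.inr)) i j := by
    intro i j
    have h1 : (ev.mapMatrix Gs.adjugate) = As.adjugate := by
      rw [RingHom.map_adjugate, RingHom.mapMatrix_apply, hG]
    rw [← h1]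
    simp only [H, Matrix.mul_apply, map_sum, map_mul]
    simp [G, ev]
  have hP : ev P = As.det * ∑ d ∈ Finset.range (n + 1), As.det ^ (n - d) *
      MvPolynomial.eval (fun ij : Fin 4 × Fin 2 =>
        (As.adjugate * A.1.submatrix id (e ∘ Sum.inr)) ij.1 ij.2)
        (MvPolynomial.homogeneousComponent d p) := by
    simp only [P, map_mul, map_sum, map_pow, hdet]
    congr 1
    refine Finset.sum_congr rfl fun d _ => ?_
    congr 1
    rw [MvPolynomial.map_aeval]
    simp only [hH]
    have : ev.comp (algebraMap ℂ _) = RingHom.id ℂ := RingHom.ext fun x => by simp [ev]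
    rw [this]
    rfl
  have key : ∀ w, (chartFrame e w).toGrass = A.toGrass →
      (ev P = 0 ↔ MvPolynomial.eval w p = 0) := by
    intro w hw
    obtain ⟨hu, hw⟩ := (chartFrame_toGrass_eq_iff e w A).1 hw
    have : (fun ij : Fin 4 × Fin 2 => (As.adjugate * A.1.submatrix id (e ∘ Sum.inr)) ij.1 ij.2) =
        As.det • w := by
      ext ⟨i, j⟩
      rw [hw, ← Matrix.mul_assoc, Matrix.adjugate_mul, Matrix.smul_mul, Matrix.one_mul]
      rfl
    have h2 : ev P = As.det ^ (n + 1) * MvPolynomial.eval w p := by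
      rw [hP, this, pow_succ', mul_assoc]
      congr 1
      conv_rhs => rw [← MvPolynomial.sum_homogeneousComponent p, map_sum, Finset.mul_sum]
      refine Finset.sum_congr rfl fun d hd => ?_
      rw [eval_smul_of_isHomogeneous (MvPolynomial.homogeneousComponent_isHomogeneous d p),
        ← mul_assoc, ← pow_add, Nat.sub_add_cancel (Nat.lt_succ_iff.1 (Finset.mem_range.1 hd))]
    rw [h2, mul_eq_zero, or_iff_right (pow_ne_zero _ hu.ne_zero)]
  simp only [Set.mem_ofPred_eq, Set.mem_singleton_iff, forall_eq]
  constructor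
  · intro h
    by_cases hu : As.det = 0
    · change ev P = 0
      rw [hP, hu, zero_mul]
    · have hu' : IsUnit As.det := isUnit_iff_ne_zero.2 hu
      have hw : (chartFrame e fun ij => (As⁻¹ * A.1.submatrix id (e ∘ Sum.inr)) ij.1 ij.2).toGrass =
          A.toGrass := by
        refine (chartFrame_toGrass_eq_iff _ _ _).2 ⟨hu', ?_⟩
        change _ = As * (As⁻¹ * A.1.submatrix id (e ∘ Sum.inr))
        rw [← Matrix.mul_assoc, Matrix.mul_nonsing_inv _ hu', Matrix.one_mul]
      exact (key _ hw).2 (h _ hw)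
  · exact fun h w hw => (key w hw).1 h

theorem exists_polynomials_of_isClosed (e : Fin 4 ⊕ Fin 2 ≃ Fin 6) {Z : Set Grass}
    (hZ : IsClosed Z) : ∃ E : Set (MvPolynomial (Fin 4 × Fin 2) ℂ), ∀ w,
      (chartFrame e w).toGrass ∈ Z ↔ ∀ p ∈ E, MvPolynomial.eval w p = 0 := by
  obtain ⟨E, hE⟩ := (isClosed_grass_iff Z).1 hZ
  refine ⟨(MvPolynomial.aeval fun ij => chartMatrix e MvPolynomial.X ij.1 ij.2) '' E, fun w => ?_⟩
  rw [hE, Set.forall_mem_image]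
  refine forall₂_congr fun p _ => ?_
  have h : (MvPolynomial.aeval (R := ℂ) w).comp
      (MvPolynomial.aeval (R := ℂ) fun ij : Fin 4 × Fin 6 =>
        chartMatrix e (R := MvPolynomial (Fin 4 × Fin 2) ℂ) MvPolynomial.X ij.1 ij.2) =
      MvPolynomial.aeval fun ij => chartMatrix e w ij.1 ij.2 := by
    ext ⟨i, j⟩
    obtain ⟨k | l, rfl⟩ := e.surjective j
    · by_cases h : i = k <;> simp [h]
    · simp
  have := congrArg (fun φ => φ p) h
  simp only [AlgHom.comp_apply] at this
  exact (Eq.congr this.symm rfl :)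

/-- The polynomials that vanish on the part of `Z` in the chart given by `e`. -/
def chartIdeal (e : Fin 4 ⊕ Fin 2 ≃ Fin 6) (Z : Set Grass) :
    Ideal (MvPolynomial (Fin 4 × Fin 2) ℂ) where
  carrier := {p | ∀ w, (chartFrame e w).toGrass ∈ Z → MvPolynomial.eval w p = 0}
  add_mem' ha hb w hw := by rw [map_add, ha w hw, hb w hw, add_zero]
  zero_mem' w _ := map_zero _
  smul_mem' c p hp w hw := by rw [smul_eq_mul, map_mul, hp w hw, mul_zero]

theorem mem_chartIdeal_iff {e : Fin 4 ⊕ Fin 2 ≃ Fin 6} {Z : Set Grass}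
    {p : MvPolynomial (Fin 4 × Fin 2) ℂ} : p ∈ chartIdeal e Z ↔
      Z ⊆ {N : Grass | ∀ w, (chartFrame e w).toGrass = N → MvPolynomial.eval w p = 0} :=
  ⟨fun h _ hN w hw => h w (hw ▸ hN), fun h w hw => h hw w rfl⟩

theorem chartIdeal_antitone (e : Fin 4 ⊕ Fin 2 ≃ Fin 6) : Antitone (chartIdeal e) :=
  fun _ _ h _ hp w hw => hp w (h hw)

theorem chartIdeal_isPrime {e : Fin 4 ⊕ Fin 2 ≃ Fin 6} {Z : Set Grass} (hZ : IsIrreducible Z)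
    {w₀ : Fin 4 × Fin 2 → ℂ} (hw : (chartFrame e w₀).toGrass ∈ Z) : (chartIdeal e Z).IsPrime := by
  refine ⟨(Ideal.ne_top_iff_one _).2 fun h => one_ne_zero ((map_one _).symm.trans (h w₀ hw)),
    fun {p q} hpq => ?_⟩
  simp only [mem_chartIdeal_iff]
  refine isPreirreducible_iff_isClosed_union_isClosed.1 hZ.2 _ _ (isClosed_chart e p)
    (isClosed_chart e q) fun N hN => ?_
  by_contra! h
  simp only [Set.mem_union, Set.mem_ofPred_eq, not_or, not_forall] at h
  obtain ⟨⟨w, rfl, h1⟩, w', h2, h3⟩ := h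
  obtain rfl : w' = w := by
    have := ((chartFrame_toGrass_eq_iff e w' (chartFrame e w)).1 h2).2
    ext ⟨i, j⟩
    simpa [chartFrame, Matrix.mul_apply] using (congrFun (congrFun this i) j).symm
  have := hpq _ hN
  rw [map_mul, mul_eq_zero] at this
  exact this.elim h1 h3

/-- `Z'` is covered by `Z` and the complement of the chart, which is closed by `isClosed_chart` for
the polynomial `1`. Irreducibility selects `Z`, as `Z'` meets the chart. -/
theorem subset_of_chartIdeal_le {e : Fin 4 ⊕ Fin 2 ≃ Fin 6} {Z Z' : Set Grass}
    (hZ : IsClosed Z) (hZ' : IsIrreducible Z') {w₀ : Fin 4 × Fin 2 → ℂ}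
    (hw : (chartFrame e w₀).toGrass ∈ Z') (h : chartIdeal e Z ≤ chartIdeal e Z') : Z' ⊆ Z := by
  obtain ⟨E, hE⟩ := exists_polynomials_of_isClosed e hZ
  refine (isPreirreducible_iff_isClosed_union_isClosed.1 hZ'.2 Z _ hZ (isClosed_chart e 1)
    fun N _ => ?_).resolve_right fun h' => ?_
  · by_cases hN' : ∃ w, (chartFrame e w).toGrass = N
    · obtain ⟨w, rfl⟩ := hN'
      exact Or.inl ((hE w).2 fun p hp => h (fun w' hw' => (hE w').1 hw' p hp) w ‹_›)
    · exact Or.inr fun w hw => (hN' ⟨w, hw⟩).elim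
  · exact one_ne_zero ((map_one _).symm.trans (h' hw w₀ rfl))

/-- A chart meeting the smallest member of a chain of irreducible closed sets meets all of them.
Their ideals in that chart form a strict chain of primes in reverse order, above the ideal of the
largest member. -/
theorem topologicalKrullDim_closure_le {d : ℕ} (S : Set Grass)
    (h : ∀ (e : Fin 4 ⊕ Fin 2 ≃ Fin 6) (P : Ideal (MvPolynomial (Fin 4 × Fin 2) ℂ)) [P.IsPrime],
      (∀ p, (∀ w, (chartFrame e w).toGrass ∈ S → MvPolynomial.eval w p = 0) → p ∈ P) →
        ringKrullDim (MvPolynomial (Fin 4 × Fin 2) ℂ ⧸ P) ≤ d) :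
    topologicalKrullDim (closure S) ≤ d := by
  refine iSup_le fun l => ?_
  obtain ⟨N, hN⟩ := l.head.isIrreducible.1
  obtain ⟨e, w, hw⟩ := exists_chart N.1
  let Z : Fin (l.length + 1) → Set Grass := fun i => Subtype.val '' (l i : Set (closure S))
  have hirr : ∀ i, IsIrreducible (Z i) := fun i =>
    (l i).isIrreducible.image _ continuous_subtype_val.continuousOn
  have hcl : ∀ i, IsClosed (Z i) := fun i =>
    isClosed_closure.isClosedEmbedding_subtypeVal.isClosedMap _ (l i).isClosed
  have hsub : ∀ i, Z i ⊆ closure S := fun i => Subtype.coe_image_subset _ _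
  have hmono : ∀ i j, i < j → Z i ⊂ Z j := fun i j hij =>
    Subtype.val_injective.image_strictMono (l.strictMono hij)
  have hmem : ∀ i, (chartFrame e w).toGrass ∈ Z i := fun i => by
    rw [hw]
    exact ⟨N, l.monotone (Fin.zero_le i) hN, rfl⟩
  have hprime : ∀ i, (chartIdeal e (Z i)).IsPrime := fun i => chartIdeal_isPrime (hirr i) (hmem i)
  have hlt : ∀ i j, i < j → chartIdeal e (Z j) < chartIdeal e (Z i) := fun i j hij =>
    lt_of_le_not_ge (chartIdeal_antitone e (hmono i j hij).1) fun hle =>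
      (hmono i j hij).2 (subset_of_chartIdeal_le (hcl i) (hirr j) (hmem j) hle)
  have hP := h e (chartIdeal e (Z (Fin.last _))) fun p hp => mem_chartIdeal_iff.2 <|
    (hsub _).trans <| closure_minimal (mem_chartIdeal_iff.1 hp) (isClosed_chart e p)
  refine le_trans ?_ hP
  rw [ringKrullDim_quotient]
  let l' : LTSeries (PrimeSpectrum.zeroLocus (R := MvPolynomial (Fin 4 × Fin 2) ℂ)
      (chartIdeal e (Z (Fin.last _)))) :=
    LTSeries.mk l.length (fun i => ⟨⟨_, hprime i.rev⟩, by
      obtain hi | hi := (Fin.le_last i.rev).eq_or_lt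
      · rw [PrimeSpectrum.mem_zeroLocus, hi]
      · exact (hlt _ _ hi).le⟩) fun i j hij => hlt _ _ (Fin.rev_lt_rev.2 hij)
  exact Order.LTSeries.length_le_krullDim l'

/-! ### Velocities of cones and of double lines over a field -/

theorem finrank_range_le_of_ker_le {K V W W' : Type*} [Field K] [AddCommGroup V] [Module K V]
    [AddCommGroup W] [Module K W] [AddCommGroup W'] [Module K W'] [FiniteDimensional K W]
    (φ : V →ₗ[K] W) (ψ : V →ₗ[K] W') (h : LinearMap.ker φ ≤ LinearMap.ker ψ) :
    Module.finrank K (LinearMap.range ψ) ≤ Module.finrank K (LinearMap.range φ) := by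
  let g := (LinearMap.ker φ).liftQ ψ h ∘ₗ φ.quotKerEquivRange.symm.toLinearMap
  have hg : LinearMap.range g = LinearMap.range ψ := by
    rw [LinearMap.range_comp, LinearEquiv.range, Submodule.map_top, Submodule.range_liftQ]
  rw [← hg]
  exact LinearMap.finrank_range_le g

theorem exists_quadratic_root {K : Type*} [Field K] [IsAlgClosed K] (x y z : K) :
    ∃ s t : K, (s ≠ 0 ∨ t ≠ 0) ∧ s ^ 2 * x + s * t * y + t ^ 2 * z = 0 := by
  by_cases hx : x = 0
  · exact ⟨1, 0, by simp, by simp [hx]⟩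
  · obtain ⟨s, hs⟩ := IsAlgClosed.exists_root
      (Polynomial.C x * Polynomial.X ^ 2 + Polynomial.C y * Polynomial.X + Polynomial.C z)
      (by rw [Polynomial.degree_quadratic hx]; norm_num)
    refine ⟨s, 1, by simp, ?_⟩
    simp [Polynomial.IsRoot] at hs
    linear_combination hs

section
variable {K : Type} [Field K] [Algebra ℂ K]

/-- A symmetric trilinear form whose cubic form is smooth and that is constant for all derivations
of the ground field. -/
structure IsSmoothPolar
    (F : (Fin 6 → K) →ₗ[K] (Fin 6 → K) →ₗ[K] (Fin 6 → K) →ₗ[K] K) : Prop where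
  swap_left : ∀ u v w, F u v w = F v u w
  swap_right : ∀ u v w, F u v w = F u w v
  derivation : ∀ (D : Derivation ℂ K K) (u v w : Fin 6 → K),
    D (F u v w) = F (D ∘ u) v w + F u (D ∘ v) w + F u v (D ∘ w)
  smooth : ∀ p, p ≠ 0 → ∃ v, F p p v ≠ 0

theorem derivation_comp_single (D : Derivation ℂ K K) (j : Fin 6) :
    D ∘ (Pi.single j (1 : K) : Fin 6 → K) = 0 := by
  ext i
  by_cases h : i = j
  · subst h; simp
  · simp [h]

/-- The identity block is constant, so rows move only along the two remaining coordinate vectors,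
which complement the row space. -/
theorem derivation_comp_chartMatrix (D : Derivation ℂ K K) (e : Fin 4 ⊕ Fin 2 ≃ Fin 6)
    (w : Fin 4 × Fin 2 → K) (i : Fin 4) :
    D ∘ chartMatrix e w i = ∑ j, D (w (i, j)) • Pi.single (e (Sum.inr j)) (1 : K) := by
  ext m
  obtain ⟨k | l, rfl⟩ := e.surjective m
  · by_cases h : i = k <;> simp [h]
  · simp [Finset.sum_apply, Pi.single_apply]

omit [Algebra ℂ K] in
theorem eq_sum_chartMatrix (e : Fin 4 ⊕ Fin 2 ≃ Fin 6) (w : Fin 4 × Fin 2 → K) (v : Fin 6 → K) :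
    ∃ ξ : Fin 2 → K, v = ∑ i, v (e (Sum.inl i)) • chartMatrix e w i +
      ∑ j, ξ j • Pi.single (e (Sum.inr j)) (1 : K) := by
  refine ⟨fun j => v (e (Sum.inr j)) - ∑ i, v (e (Sum.inl i)) * w (i, j), ?_⟩
  ext m
  obtain ⟨k | l, rfl⟩ := e.surjective m
  · simp [Finset.sum_apply]
  · fin_cases l <;> simp [Finset.sum_apply]

omit [Algebra ℂ K] in
theorem sum_smul_chartMatrix_inl (e : Fin 4 ⊕ Fin 2 ≃ Fin 6) (w : Fin 4 × Fin 2 → K)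
    (c : Fin 4 → K) (k : Fin 4) : (∑ i, c i • chartMatrix e w i) (e (Sum.inl k)) = c k := by
  simp [Finset.sum_apply]

omit [Algebra ℂ K] in
theorem eq_zero_of_chartMatrix (e : Fin 4 ⊕ Fin 2 ≃ Fin 6) (w : Fin 4 × Fin 2 → K)
    (φ : (Fin 6 → K) →ₗ[K] K) (h1 : ∀ i, φ (chartMatrix e w i) = 0)
    (h2 : ∀ j, φ (Pi.single (e (Sum.inr j)) 1) = 0) (v : Fin 6 → K) : φ v = 0 := by
  obtain ⟨ξ, hξ⟩ := eq_sum_chartMatrix e w v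
  rw [hξ]
  simp [h1, h2, map_sum]

variable [IsAlgClosed K] {F : (Fin 6 → K) →ₗ[K] (Fin 6 → K) →ₗ[K] (Fin 6 → K) →ₗ[K] K}

namespace IsSmoothPolar

/-- Eckardt points do not move. -/
theorem derivation_eckardt_eq_zero (hF : IsSmoothPolar F) {p : Fin 6 → K} {m : Fin 6}
    (hm : p m = 1) (hpp : F p p p = 0)
    (hB : ∀ x y, F p p x = 0 → F p p y = 0 → F p x y = 0) (D : Derivation ℂ K K) : D ∘ p = 0 := by
  have : CharZero K := charZero_of_injective_algebraMap (algebraMap ℂ K).injective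
  have hp0 : p ≠ 0 := fun h => by simp [h] at hm
  obtain ⟨v, hv⟩ := hF.smooth p hp0
  set q : Fin 6 → K := D ∘ p with hq
  have hqm : q m = 0 := by simp [hq, hm]
  let z := (F p p v)⁻¹ • v
  have hz : F p p z = 1 := by simp [z, hv]
  -- `F p` vanishes on `ker (F p p)`, hence is the symmetrized product of `F p p` with a linear
  -- form. Evaluating at `z`, where `F p p z = 1`, determines that form.
  let μ : (Fin 6 → K) →ₗ[K] K := F p z - (2⁻¹ * F p z z) • F p p
  have hμ : ∀ x y, F p x y = F p p x * μ y + F p p y * μ x := fun x y => by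
    have h := hB (x - F p p x • z) (y - F p p y • z) (by simp [hz]) (by simp [hz])
    simp only [map_sub, map_smul, LinearMap.sub_apply, LinearMap.smul_apply, smul_eq_mul] at h
    simp only [μ, LinearMap.sub_apply, LinearMap.smul_apply, smul_eq_mul]
    rw [hF.swap_right p x z] at h
    linear_combination h
  have hlq : F p p q = 0 := by
    have := hF.derivation D p p p
    rw [hpp, map_zero, ← hq, hF.swap_left q p p, hF.swap_right p q p] at this
    have h3 : (3 : K) * F p p q = 0 := by linear_combination -this
    simpa using h3
  let μ' : (Fin 6 → K) →ₗ[K] K := Fintype.linearCombination K fun b => D (μ (Pi.single b 1))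
  have hμ' : ∀ b, μ' (Pi.single b 1) = D (μ (Pi.single b 1)) := fun b => by
    simp [μ', Fintype.linearCombination_apply_single]
  -- Differentiating the factorization of `F p` gives one of `F q`. The derivative of `F p p` is `2
  -- μ(q) F p p`, because `F p p q = 0`; this accounts for the second summand.
  let ν := μ' + (2 * μ q) • μ
  have hν' : ∀ a b, F q (Pi.single a 1) (Pi.single b 1) =
      F p p (Pi.single a 1) * ν (Pi.single b 1) + F p p (Pi.single b 1) * ν (Pi.single a 1) := by
    intro a b
    have hl : ∀ a, D (F p p (Pi.single a 1)) = 2 * μ q * F p p (Pi.single a 1) := fun a => by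
      rw [hF.derivation, derivation_comp_single, map_zero, ← hq, hF.swap_left q p, hμ q, hlq]
      ring
    have h1 := hF.derivation D p (Pi.single a 1) (Pi.single b 1)
    rw [derivation_comp_single, derivation_comp_single, hμ, map_add, D.leibniz, D.leibniz, hl, hl,
      ← hq] at h1
    simp only [map_zero, LinearMap.zero_apply, smul_eq_mul] at h1
    simp only [ν, LinearMap.add_apply, LinearMap.smul_apply, smul_eq_mul, hμ']
    linear_combination -h1
  have hν : ∀ x y, F q x y = F p p x * ν y + F p p y * ν x := by
    intro x y
    have hx : x = ∑ a, x a • Pi.single a 1 := pi_eq_sum_univ' x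
    have hy : y = ∑ a, y a • Pi.single a 1 := pi_eq_sum_univ' y
    have : F q = LinearMap.mk₂ K (fun x y => F p p x * ν y + F p p y * ν x)
        (by intros; simp; ring) (by intros; simp; ring) (by intros; simp; ring)
        (by intros; simp; ring) := by
      refine (Pi.basisFun K (Fin 6)).ext fun a => (Pi.basisFun K (Fin 6)).ext fun b => ?_
      simpa using hν' a b
    rw [this, LinearMap.mk₂_apply]
  have hμp : μ p = 1 := by
    have := hμ p z
    rw [hpp, hz] at this
    simpa using this.symm
  by_contra hne
  -- For `P = s p + t q` the form `F P P` is `F p p` times this quadratic in `s`, `t`. A root gives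
  -- a nonzero `P` violating smoothness.
  obtain ⟨s, t, hst, h⟩ := exists_quadratic_root (μ p) (μ q + ν p) (ν q)
  have hP : s • p + t • q ≠ 0 := fun h0 => by
    have h1 := congrFun h0 m
    simp [hm, hqm] at h1
    rw [h1, zero_smul, zero_add, smul_eq_zero, or_iff_left hne] at h0
    simp [h1, h0] at hst
  obtain ⟨y, hy⟩ := hF.smooth _ hP
  refine hy ?_
  have h1 : ∀ P y, F (s • p + t • q) P y = s * F p P y + t * F q P y := fun P y => by simp
  rw [h1, hμ, hν]
  simp only [map_add, map_smul, smul_eq_mul, hpp, hlq]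
  linear_combination F p p y * h

/-- The tangent hyperplane `ker (F p p)` at the vertex is spanned by the rows and one further vector
`t`. The argument splits according to whether `F p` vanishes on that hyperplane. -/
theorem finrank_cone_le (hF : IsSmoothPolar F) (e : Fin 4 ⊕ Fin 2 ≃ Fin 6)
    (w : Fin 4 × Fin 2 → K) (c : Fin 4 → K) (k : Fin 4) (hk : c k = 1)
    (h : ∀ i j, F (∑ i, c i • chartMatrix e w i) (chartMatrix e w i) (chartMatrix e w j) = 0) :
    Module.finrank K (LinearMap.range (derivationEval w)) ≤ 4 := by
  have : CharZero K := charZero_of_injective_algebraMap (algebraMap ℂ K).injective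
  set p := ∑ i, c i • chartMatrix e w i with hp
  set U := chartMatrix e w with hU
  let E : Fin 2 → Fin 6 → K := fun j => Pi.single (e (Sum.inr j)) 1
  have hDE : ∀ (D : Derivation ℂ K K) j, D ∘ E j = 0 := fun D j => derivation_comp_single D _
  have hDU : ∀ (D : Derivation ℂ K K) i, D ∘ U i = D (w (i, 0)) • E 0 + D (w (i, 1)) • E 1 :=
    fun D i => (derivation_comp_chartMatrix D e w i).trans (Fin.sum_univ_two _)
  have hpk : p (e (Sum.inl k)) = 1 := (sum_smul_chartMatrix_inl e w c k).trans hk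
  have hlU : ∀ i, F p p (U i) = 0 := fun i => by
    nth_rw 2 [hp]
    simp [map_sum, h]
  have hlp : F p p p = 0 := by
    nth_rw 3 [hp]
    simp [map_sum, hlU]
  have hp0 : p ≠ 0 := fun h => by simp [h] at hpk
  obtain ⟨v₀, hv₀⟩ := hF.smooth p hp0
  have hlE : F p p (E 0) ≠ 0 ∨ F p p (E 1) ≠ 0 := by
    by_contra! hE
    exact hv₀ (eq_zero_of_chartMatrix e w _ hlU (Fin.forall_fin_two.2 hE) v₀)
  have hpar : ∀ x y : K, x * F p p (E 0) + y * F p p (E 1) = 0 →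
      ∃ d, x = -(d * F p p (E 1)) ∧ y = d * F p p (E 0) := by
    intro x y hxy
    rcases hlE with h0 | h1
    · refine ⟨y / F p p (E 0), ?_, by field_simp⟩
      field_simp
      linear_combination hxy
    · refine ⟨-x / F p p (E 1), by field_simp, ?_⟩
      field_simp
      linear_combination hxy
  let t := -F p p (E 1) • E 0 + F p p (E 0) • E 1
  have hlDU : ∀ D : Derivation ℂ K K, D ∘ p = 0 → ∀ i, F p p (D ∘ U i) = 0 := fun D hD i => by
    have := hF.derivation D p p (U i)
    rw [hlU, hD] at this
    simpa using this.symm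
  -- `F p` already vanishes on pairs of rows, so `hA` says exactly that it is nonzero on the tangent
  -- hyperplane. Then a derivation killing `p` moves each row by a multiple `d i` of `t`, and
  -- differentiating `h` forces `d = 0`.
  by_cases hA : (∃ j, F p t (U j) ≠ 0) ∨ F p t t ≠ 0
  · have hker : LinearMap.ker (derivationEval p) ≤ LinearMap.ker (derivationEval w) := by
      intro D hD
      have hD : D ∘ p = 0 := hD
      have hd : ∀ i, ∃ d, D (w (i, 0)) = -(d * F p p (E 1)) ∧ D (w (i, 1)) = d * F p p (E 0) :=
        fun i => hpar _ _ (by simpa [hDU] using hlDU D hD i)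
      choose d hd0 hd1 using hd
      have hDU' : ∀ i, D ∘ U i = d i • t := fun i => by
        rw [hDU, hd0, hd1, smul_add, smul_smul, smul_smul, mul_neg]
      have hDt : D ∘ t = 0 := by
        have hDl : ∀ j, D (F p p (E j)) = 0 := fun j => by
          rw [hF.derivation, hD, hDE]; simp
        ext m
        have h0 := congrFun (hDE D 0) m
        have h1 := congrFun (hDE D 1) m
        simp only [Function.comp_apply, Pi.zero_apply] at h0 h1
        simp [t, hDl, h0, h1]
      have hd0' : ∀ i, d i = 0 := by
        have h1 : ∀ i j, d i * F p t (U j) + d j * F p t (U i) = 0 := fun i j => by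
          have := hF.derivation D p (U i) (U j)
          rw [h, hD, hDU', hDU', hF.swap_right p (U i)] at this
          simpa using this.symm
        by_cases hj : ∃ j, F p t (U j) ≠ 0
        · obtain ⟨j, hj⟩ := hj
          have hdj : d j = 0 := by
            have := h1 j j
            rw [← two_mul] at this
            simpa [hj] using this
          intro i
          have := h1 i j
          simpa [hdj, hj] using this
        · push Not at hj
          intro i
          have := hF.derivation D p t (U i)
          rw [hj, hD, hDt, hDU'] at this
          have htt := hA.resolve_left (by push Not; exact hj)
          simpa [htt] using this.symm
      ext ⟨i, j⟩
      fin_cases j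
      · simp [hd0, hd0']
      · simp [hd1, hd0']
    refine (finrank_range_le_of_ker_le _ _ hker).trans ?_
    -- The velocity of `p` obeys two independent conditions, tangency to the cubic and the
    -- normalized coordinate, leaving `6 - 2 = 4`.
    let Θ : (Fin 6 → K) →ₗ[K] K × K := (F p p).prod (LinearMap.proj (e (Sum.inl k)))
    have hΘ : LinearMap.range Θ = ⊤ := by
      refine LinearMap.range_eq_top.2 fun ⟨x, y⟩ => ?_
      refine ⟨(x / F p p v₀) • (v₀ - v₀ (e (Sum.inl k)) • p) + y • p, ?_⟩
      simp [Θ, hlp, hpk, hv₀]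
    have hle : LinearMap.range (derivationEval p) ≤ LinearMap.ker Θ := by
      rintro _ ⟨D, rfl⟩
      have h1 : derivationEval p D = D ∘ p := rfl
      have h2 := hF.derivation D p p p
      rw [hlp, map_zero, hF.swap_left (D ∘ p) p p, hF.swap_right p (D ∘ p) p] at h2
      have h3 : (3 : K) * F p p (D ∘ p) = 0 := by linear_combination -h2
      have h4 : F p p (D ∘ p) = 0 := by simpa using h3
      rw [h1, LinearMap.mem_ker]
      simp [Θ, h4, hpk]
    have := LinearMap.finrank_range_add_finrank_ker Θ
    rw [hΘ, finrank_top] at this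
    simp at this
    have := Submodule.finrank_mono hle
    lia
  · push Not at hA
    have hB : ∀ x y, F p p x = 0 → F p p y = 0 → F p x y = 0 := by
      have hdec : ∀ x, F p p x = 0 → ∃ d : K, x = ∑ i, x (e (Sum.inl i)) • U i + d • t := by
        intro x hx
        obtain ⟨ξ, hξ⟩ := eq_sum_chartMatrix e w x
        rw [Fin.sum_univ_two] at hξ
        change x = ∑ i, x (e (Sum.inl i)) • U i + (ξ 0 • E 0 + ξ 1 • E 1) at hξ
        obtain ⟨d, hd0, hd1⟩ := hpar (ξ 0) (ξ 1) (by
          rw [hξ] at hx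
          simpa [map_sum, hlU] using hx)
        refine ⟨d, hξ.trans ?_⟩
        rw [hd0, hd1, smul_add, smul_smul, smul_smul, mul_neg]
      intro x y hx hy
      obtain ⟨d, hd⟩ := hdec x hx
      obtain ⟨d', hd'⟩ := hdec y hy
      rw [hd, hd']
      simp [map_sum, h, hA, hF.swap_right p (U _) t]
    have hDp := hF.derivation_eckardt_eq_zero hpk hlp hB
    -- With `p` fixed, each row stays in the tangent hyperplane: one condition per row on `8`
    -- coordinates.
    let Θ : (Fin 4 × Fin 2 → K) →ₗ[K] (Fin 4 → K) := LinearMap.pi fun i =>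
      F p p (E 0) • LinearMap.proj (i, 0) + F p p (E 1) • LinearMap.proj (i, 1)
    have hΘ : LinearMap.range Θ = ⊤ := by
      refine LinearMap.range_eq_top.2 fun x => ?_
      rcases hlE with h0 | h1
      · refine ⟨fun ij => if ij.2 = 0 then x ij.1 / F p p (E 0) else 0, ?_⟩
        ext i
        simp [Θ]
        field_simp
      · refine ⟨fun ij => if ij.2 = 1 then x ij.1 / F p p (E 1) else 0, ?_⟩
        ext i
        simp [Θ]
        field_simp
    have hle : LinearMap.range (derivationEval w) ≤ LinearMap.ker Θ := by
      rintro _ ⟨D, rfl⟩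
      rw [LinearMap.mem_ker]
      ext i
      have := hlDU D (hDp D) i
      rw [hDU] at this
      simp at this
      simp [Θ]
      linear_combination this
    have := LinearMap.finrank_range_add_finrank_ker Θ
    rw [hΘ, finrank_top] at this
    simp at this
    have := Submodule.finrank_mono hle
    lia

end IsSmoothPolar
end
section
variable {K : Type} [Field K] [Algebra ℂ K]
variable [IsAlgClosed K] {F : (Fin 6 → K) →ₗ[K] (Fin 6 → K) →ₗ[K] (Fin 6 → K) →ₗ[K] K}

omit [Algebra ℂ K] in
/-- A base point free pencil of quadrics on the line satisfies no two consecutive linear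
relations. -/
theorem eq_zero_of_consecutive_relations {V : Type*} [AddCommGroup V] [Module K V]
    (α β γ : V →ₗ[K] K) (hne : ∀ s t : K, (s ≠ 0 ∨ t ≠ 0) →
      ∃ v, s ^ 2 * α v + s * t * (2 * β v) + t ^ 2 * γ v ≠ 0)
    (c : Fin 4 → K) (h1 : ∀ v, c 0 * α v + c 1 * (2 * β v) + c 2 * γ v = 0)
    (h2 : ∀ v, c 1 * α v + c 2 * (2 * β v) + c 3 * γ v = 0) : c = 0 := by
  -- The triple `(α v, 2 β v, γ v)` is orthogonal to `(c₀, c₁, c₂)` and `(c₁, c₂, c₃)`, so it is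
  -- parallel to their cross product, whose entries are the coefficients here. Were one of them
  -- nonzero, `(s, t)` would be a base point.
  obtain ⟨s, t, hst, h⟩ := exists_quadratic_root (c 1 * c 3 - c 2 ^ 2) (c 2 * c 1 - c 0 * c 3)
    (c 0 * c 2 - c 1 ^ 2)
  obtain ⟨v, hv⟩ := hne s t hst
  have e1 := h1 v
  have e2 := h2 v
  have hn1 : c 1 * c 3 - c 2 ^ 2 = 0 := by
    by_contra h0
    refine hv (mul_left_cancel₀ h0 ?_)
    linear_combination α v * h + s * t * (c 3 * e1 - c 2 * e2) - t ^ 2 * (c 2 * e1 - c 1 * e2)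
  have hn2 : c 2 * c 1 - c 0 * c 3 = 0 := by
    by_contra h0
    refine hv (mul_left_cancel₀ h0 ?_)
    linear_combination 2 * β v * h - s ^ 2 * (c 3 * e1 - c 2 * e2) + t ^ 2 * (c 1 * e1 - c 0 * e2)
  have hn3 : c 0 * c 2 - c 1 ^ 2 = 0 := by
    by_contra h0
    refine hv (mul_left_cancel₀ h0 ?_)
    linear_combination γ v * h + s ^ 2 * (c 2 * e1 - c 1 * e2) - s * t * (c 1 * e1 - c 0 * e2)
  by_cases hc0 : c 0 = 0
  · have hc1 : c 1 = 0 := by simpa [hc0] using hn3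
    have hc2 : c 2 = 0 := by simpa [hc1] using hn1
    obtain ⟨v, hv⟩ := hne 0 1 (by simp)
    have hc3 : c 3 = 0 := by
      have := h2 v
      simp [hc1, hc2] at this hv
      tauto
    ext i
    fin_cases i <;> assumption
  -- All minors vanish, so `c` lies over the twisted cubic and the first relation says that `(c₀,
  -- c₁)` is a base point.
  · obtain ⟨v, hv⟩ := hne (c 0) (c 1) (Or.inl hc0)
    refine (hv ?_).elim
    linear_combination c 0 * h1 v - γ v * hn3

namespace IsSmoothPolar

/-- Once `p` and `q` are fixed, `W` is fixed. Their velocities satisfy eight independent conditions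
in a twelve-dimensional space; independence means that a base point free system of binary quadrics,
multiplied by linear forms, gives all binary cubics. -/
theorem finrank_line_le (hF : IsSmoothPolar F) (e : Fin 4 ⊕ Fin 2 ≃ Fin 6)
    (w : Fin 4 × Fin 2 → K) (a b : Fin 4 → K) (k l : Fin 4) (hak : a k = 1) (hal : a l = 0)
    (hbk : b k = 0) (hbl : b l = 1)
    (haa : ∀ i, F (∑ i, a i • chartMatrix e w i) (∑ i, a i • chartMatrix e w i)
      (chartMatrix e w i) = 0)
    (hab : ∀ i, F (∑ i, a i • chartMatrix e w i) (∑ i, b i • chartMatrix e w i)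
      (chartMatrix e w i) = 0)
    (hbb : ∀ i, F (∑ i, b i • chartMatrix e w i) (∑ i, b i • chartMatrix e w i)
      (chartMatrix e w i) = 0) :
    Module.finrank K (LinearMap.range (derivationEval w)) ≤ 4 := by
  have : CharZero K := charZero_of_injective_algebraMap (algebraMap ℂ K).injective
  have hpak := (sum_smul_chartMatrix_inl e w a k).trans hak
  have hpal := (sum_smul_chartMatrix_inl e w a l).trans hal
  have hpbk := (sum_smul_chartMatrix_inl e w b k).trans hbk
  have hpbl := (sum_smul_chartMatrix_inl e w b l).trans hbl
  have hker : ∀ φ : (Fin 6 → K) →ₗ[K] K, (∀ i, φ (chartMatrix e w i) = 0) →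
      φ (∑ i, a i • chartMatrix e w i) = 0 ∧ φ (∑ i, b i • chartMatrix e w i) = 0 :=
    fun φ hφ => by simp [map_sum, hφ]
  set p := ∑ i, a i • chartMatrix e w i
  set q := ∑ i, b i • chartMatrix e w i
  set U := chartMatrix e w with hU
  let E : Fin 2 → Fin 6 → K := fun j => Pi.single (e (Sum.inr j)) 1
  have hDU : ∀ (D : Derivation ℂ K K) i, D ∘ U i = D (w (i, 0)) • E 0 + D (w (i, 1)) • E 1 :=
    fun D i => (derivation_comp_chartMatrix D e w i).trans (Fin.sum_univ_two _)
  have hne : ∀ s t : K, (s ≠ 0 ∨ t ≠ 0) →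
      ∃ v, s ^ 2 * F p p v + s * t * (2 * F p q v) + t ^ 2 * F q q v ≠ 0 := by
    intro s t hst
    have h0 : s • p + t • q ≠ 0 := fun h => by
      have h1 := congrFun h (e (Sum.inl k))
      have h2 := congrFun h (e (Sum.inl l))
      simp [hpak, hpbk, hpal, hpbl] at h1 h2
      simp [h1, h2] at hst
    obtain ⟨v, hv⟩ := hF.smooth _ h0
    refine ⟨v, fun h => hv ?_⟩
    simp [hF.swap_left q p]
    linear_combination h
  obtain ⟨happ, hapq⟩ := hker (F p p) haa
  obtain ⟨hbpp, hbpq⟩ := hker (F p q) hab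
  obtain ⟨hcpp, hcpq⟩ := hker (F q q) hbb
  have hkerle : LinearMap.ker ((derivationEval p).prod (derivationEval q)) ≤
      LinearMap.ker (derivationEval w) := by
    intro D hD
    rw [LinearMap.ker_prod] at hD
    have hDp : D ∘ p = 0 := hD.1
    have hDq : D ∘ q = 0 := hD.2
    have key : ∀ (x y : Fin 6 → K), D ∘ x = 0 → D ∘ y = 0 → (∀ i, F x y (U i) = 0) →
        ∀ i, F x y (E 0) * D (w (i, 0)) + F x y (E 1) * D (w (i, 1)) = 0 := by
      intro x y hx hy hxy i
      have := hF.derivation D x y (U i)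
      rw [hxy, hx, hy, hDU] at this
      simp at this
      linear_combination -this
    have k1 := key p p hDp hDp haa
    have k2 := key p q hDp hDq hab
    have k3 := key q q hDq hDq hbb
    -- Some member `φ` of the conic family `F P P`, with `P` on the line, kills one complementary
    -- vector. If `D (w (i, j))` were nonzero, the differentiated equations would make `φ` kill the
    -- other one too, hence everything.
    have hres : ∀ j j' : Fin 2, j ≠ j' → ∀ i, D (w (i, j)) = 0 := by
      intro j j' hjj i
      by_contra h0
      obtain ⟨s, t, hst, h⟩ := exists_quadratic_root (F p p (E j')) (2 * F p q (E j'))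
        (F q q (E j'))
      obtain ⟨v, hv⟩ := hne s t hst
      let φ := s ^ 2 • F p p + (s * t * 2) • F p q + t ^ 2 • F q q
      have hφ : ∀ v, φ v = s ^ 2 * F p p v + s * t * (2 * F p q v) + t ^ 2 * F q q v := fun v => by
        simp [φ, mul_assoc]
      have hφj' : φ (E j') = 0 := by rw [hφ, h]
      have hφj : φ (E j) = 0 := by
        refine mul_right_cancel₀ h0 ?_
        have hsum : φ (E 0) * D (w (i, 0)) + φ (E 1) * D (w (i, 1)) = 0 := by
          rw [hφ, hφ]
          linear_combination s ^ 2 * k1 i + s * t * 2 * k2 i + t ^ 2 * k3 i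
        obtain ⟨rfl, rfl⟩ | ⟨rfl, rfl⟩ : (j = 0 ∧ j' = 1) ∨ (j = 1 ∧ j' = 0) := by lia
        · rwa [hφj', zero_mul, add_zero, ← zero_mul (D (w (i, 0)))] at hsum
        · rwa [hφj', zero_mul, zero_add, ← zero_mul (D (w (i, 1)))] at hsum
      refine hv ?_
      rw [← hφ]
      refine eq_zero_of_chartMatrix e w φ (fun i => ?_) (fun m => ?_) v
      · rw [hφ, haa, hab, hbb]; ring
      · change φ (E m) = 0
        obtain rfl | rfl : m = j ∨ m = j' := by lia
        · exact hφj
        · exact hφj'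
    ext ⟨i, j⟩
    fin_cases j
    · exact hres 0 1 (by simp) i
    · exact hres 1 0 (by simp) i
  refine (finrank_range_le_of_ker_le _ _ hkerle).trans ?_
  -- Four normalized coordinates, then the four coefficients, up to the factor `3`, of the
  -- derivative of the binary cubic obtained by restricting `F` to the line.
  let α : (Fin 6 → K) × (Fin 6 → K) →ₗ[K] (Fin 8 → K) := LinearMap.pi ![
    LinearMap.proj (e (Sum.inl k)) ∘ₗ LinearMap.fst K _ _,
    LinearMap.proj (e (Sum.inl l)) ∘ₗ LinearMap.fst K _ _,
    LinearMap.proj (e (Sum.inl k)) ∘ₗ LinearMap.snd K _ _,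
    LinearMap.proj (e (Sum.inl l)) ∘ₗ LinearMap.snd K _ _,
    F p p ∘ₗ LinearMap.fst K _ _,
    (2 • F p q) ∘ₗ LinearMap.fst K _ _ + F p p ∘ₗ LinearMap.snd K _ _,
    F q q ∘ₗ LinearMap.fst K _ _ + (2 • F p q) ∘ₗ LinearMap.snd K _ _,
    F q q ∘ₗ LinearMap.snd K _ _]
  have hα : LinearMap.range α = ⊤ := by
    by_contra hlt
    obtain ⟨φ, hφ, hle⟩ := Submodule.exists_le_ker_of_lt_top _ (lt_top_iff_ne_top.2 hlt)
    let c : Fin 8 → K := fun i => φ (Pi.single i 1)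
    have hφc : ∀ x, φ x = ∑ i, x i * c i := fun x => by
      conv_lhs => rw [pi_eq_sum_univ' x, map_sum]
      simp [c]
    have hc : ∀ x, ∑ i, α x i * c i = 0 := fun x => by
      rw [← hφc]; exact hle ⟨x, rfl⟩
    have e1 : ∀ x, x (e (Sum.inl k)) * c 0 + x (e (Sum.inl l)) * c 1 + F p p x * c 4 +
        2 * F p q x * c 5 + F q q x * c 6 = 0 := fun x => by
      have := hc (x, 0)
      simp [Fin.sum_univ_eight, α] at this
      linear_combination this
    have e2 : ∀ x, x (e (Sum.inl k)) * c 2 + x (e (Sum.inl l)) * c 3 + F p p x * c 5 +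
        2 * F p q x * c 6 + F q q x * c 7 = 0 := fun x => by
      have := hc (0, x)
      simp [Fin.sum_univ_eight, α] at this
      linear_combination this
    -- At `p` and `q` the three polar forms vanish, so evaluation there isolates the coefficients of
    -- the normalization conditions.
    have c0 : c 0 = 0 := by simpa [hpak, hpal, happ, hbpp, hcpp] using e1 p
    have c1 : c 1 = 0 := by simpa [hpbk, hpbl, hapq, hbpq, hcpq] using e1 q
    have c2 : c 2 = 0 := by simpa [hpak, hpal, happ, hbpp, hcpp] using e2 p
    have c3 : c 3 = 0 := by simpa [hpbk, hpbl, hapq, hbpq, hcpq] using e2 q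
    have hc4 := eq_zero_of_consecutive_relations (F p p) (F p q) (F q q) hne
      ![c 4, c 5, c 6, c 7] (fun v => by have := e1 v; simp [c0, c1] at this ⊢; linear_combination this)
      (fun v => by have := e2 v; simp [c2, c3] at this ⊢; linear_combination this)
    have c4 : c 4 = 0 := congrFun hc4 0
    have c5 : c 5 = 0 := congrFun hc4 1
    have c6 : c 6 = 0 := congrFun hc4 2
    have c7 : c 7 = 0 := congrFun hc4 3
    refine hφ (LinearMap.ext fun x => ?_)
    rw [hφc]
    simp [Fin.sum_univ_eight, *]
  have hle : LinearMap.range ((derivationEval p).prod (derivationEval q)) ≤ LinearMap.ker α := by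
    rintro _ ⟨D, rfl⟩
    have h1 : ((derivationEval p).prod (derivationEval q)) D = (D ∘ p, D ∘ q) := rfl
    rw [h1, LinearMap.mem_ker]
    have d1 := hF.derivation D p p p
    have d2 := hF.derivation D p p q
    have d3 := hF.derivation D q q p
    have d4 := hF.derivation D q q q
    rw [happ, map_zero, hF.swap_left (D ∘ p) p p, hF.swap_right p (D ∘ p) p] at d1
    rw [hapq, map_zero, hF.swap_left (D ∘ p) p q, hF.swap_right p (D ∘ p) q] at d2
    rw [hcpp, map_zero, hF.swap_right (D ∘ q) q p, hF.swap_left (D ∘ q) p q,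
      hF.swap_right p (D ∘ q) q, hF.swap_left q (D ∘ q) p, hF.swap_right (D ∘ q) q p,
      hF.swap_left (D ∘ q) p q, hF.swap_right p (D ∘ q) q] at d3
    rw [hcpq, map_zero, hF.swap_left (D ∘ q) q q, hF.swap_right q (D ∘ q) q] at d4
    ext i
    fin_cases i
    · simp [α, hpak]
    · simp [α, hpal]
    · simp [α, hpbk]
    · simp [α, hpbl]
    · have h : (3 : K) * F p p (D ∘ p) = 0 := by linear_combination -d1
      simpa [α] using h
    · simp [α]
      linear_combination -d2
    · simp [α]
      linear_combination -d3
    · have h : (3 : K) * F q q (D ∘ q) = 0 := by linear_combination -d4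
      simpa [α] using h
  have := LinearMap.finrank_range_add_finrank_ker α
  rw [hα, finrank_top] at this
  simp at this
  have := Submodule.finrank_mono hle
  lia

end IsSmoothPolar
end
end CubicFourfold

/-! ### The polar form of a cubic, and the two incidence varieties -/

namespace CubicFourfold
open MvPolynomial

/-- The third partial derivatives of a cubic form. -/
noncomputable def thirdDeriv (f : MvPolynomial (Fin 6) ℂ) (i j k : Fin 6) : ℂ :=
  coeff 0 (pderiv k (pderiv j (pderiv i f)))

/-- The symmetric trilinear form of a cubic form, over a `ℂ`-algebra. -/
noncomputable def polar (f : MvPolynomial (Fin 6) ℂ) (R : Type*) [CommRing R] [Algebra ℂ R] :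
    (Fin 6 → R) →ₗ[R] (Fin 6 → R) →ₗ[R] (Fin 6 → R) →ₗ[R] R :=
  LinearMap.mk₂ R (fun u v => ∑ k, (∑ i, ∑ j, algebraMap ℂ R (thirdDeriv f i j k) * u i * v j) •
    LinearMap.proj k)
    (fun u u' v => by simp [mul_add, add_mul, Finset.sum_add_distrib, add_smul])
    (fun c u v => by
      simp only [Finset.smul_sum, smul_smul, Finset.mul_sum, Pi.smul_apply, smul_eq_mul]
      simp only [mul_assoc, mul_left_comm])
    (fun u v v' => by simp [mul_add, Finset.sum_add_distrib, add_smul])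
    (fun c u v => by
      simp only [Finset.smul_sum, smul_smul, Finset.mul_sum, Pi.smul_apply, smul_eq_mul]
      simp only [mul_assoc, mul_left_comm])

section
variable (f : MvPolynomial (Fin 6) ℂ) {R : Type*} [CommRing R] [Algebra ℂ R]

theorem polar_apply (u v w : Fin 6 → R) :
    polar f R u v w = ∑ k, ∑ i, ∑ j, algebraMap ℂ R (thirdDeriv f i j k) * u i * v j * w k := by
  simp [polar, LinearMap.sum_apply, Finset.sum_mul]

omit [CommRing R] [Algebra ℂ R] in
theorem pderiv_pderiv_comm (i j : Fin 6) : pderiv i (pderiv j f) = pderiv j (pderiv i f) := by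
  have h : ⁅pderiv (R := ℂ) i, pderiv (R := ℂ) j⁆ = 0 := by
    refine derivation_ext fun k => ?_
    rw [Derivation.commutator_apply]
    simp [pderiv_X, Pi.single_apply, apply_ite]
  have := congrArg (fun D => D f) h
  rwa [Derivation.commutator_apply, Derivation.zero_apply, sub_eq_zero] at this

theorem thirdDeriv_swap_left (i j k : Fin 6) : thirdDeriv f i j k = thirdDeriv f j i k := by
  rw [thirdDeriv, thirdDeriv, pderiv_pderiv_comm f i j]

theorem thirdDeriv_swap_right (i j k : Fin 6) : thirdDeriv f i j k = thirdDeriv f i k j := by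
  rw [thirdDeriv, thirdDeriv, pderiv_pderiv_comm _ j k]

theorem polar_swap_left (u v w : Fin 6 → R) : polar f R u v w = polar f R v u w := by
  rw [polar_apply, polar_apply]
  refine Finset.sum_congr rfl fun k _ => ?_
  rw [Finset.sum_comm]
  refine Finset.sum_congr rfl fun i _ => Finset.sum_congr rfl fun j _ => ?_
  rw [thirdDeriv_swap_left]; ring

theorem polar_swap_right (u v w : Fin 6 → R) : polar f R u v w = polar f R u w v := by
  rw [polar_apply, polar_apply, Finset.sum_comm]
  conv_rhs => rw [Finset.sum_comm]
  refine Finset.sum_congr rfl fun k _ => ?_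
  rw [Finset.sum_comm]
  refine Finset.sum_congr rfl fun i _ => Finset.sum_congr rfl fun j _ => ?_
  rw [thirdDeriv_swap_right]; ring

theorem map_polar {S : Type*} [CommRing S] [Algebra ℂ S] (φ : R →ₐ[ℂ] S) (u v w : Fin 6 → R) :
    φ (polar f R u v w) = polar f S (φ ∘ u) (φ ∘ v) (φ ∘ w) := by
  simp [polar_apply, map_sum]

theorem derivation_polar (D : Derivation ℂ R R) (u v w : Fin 6 → R) :
    D (polar f R u v w) =
      polar f R (D ∘ u) v w + polar f R u (D ∘ v) w + polar f R u v (D ∘ w) := by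
  simp only [polar_apply, map_sum, ← Finset.sum_add_distrib]
  refine Finset.sum_congr rfl fun k _ => Finset.sum_congr rfl fun i _ =>
    Finset.sum_congr rfl fun j _ => ?_
  simp
  ring

variable {f}

/-- Euler's relation, applied to a first derivative and then to the second derivatives. -/
theorem polar_self_single (hf : f.IsHomogeneous 3) (x : Fin 6 → R) (i : Fin 6) :
    polar f R x x (Pi.single i 1) = 2 * aeval x (pderiv i f) := by
  have h1 : (pderiv i f).IsHomogeneous 2 := hf.pderiv
  have h2 : ∀ j, (pderiv j (pderiv i f)).IsHomogeneous 1 := fun j => h1.pderiv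
  have h3 : ∀ j k, pderiv k (pderiv j (pderiv i f)) = C (thirdDeriv f i j k) := fun j k =>
    totalDegree_eq_zero_iff_eq_C.1 (Nat.le_zero.1 (h2 j).pderiv.totalDegree_le)
  have e1 := h1.sum_X_mul_pderiv
  have e2 := fun j => (h2 j).sum_X_mul_pderiv
  simp only [h3] at e2
  have e1' := congrArg (aeval x) e1
  have e2' := fun j => congrArg (aeval x) (e2 j)
  simp only [map_sum, map_mul, aeval_X, one_smul, aeval_C, map_nsmul] at e1' e2'
  rw [polar_swap_right, polar_swap_left, polar_apply, Finset.sum_comm,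
    Finset.sum_eq_single i (fun i' _ h => by simp [h]) (by simp), Finset.sum_comm]
  simp only [nsmul_eq_mul, Nat.cast_ofNat] at e1'
  rw [← e1']
  refine Finset.sum_congr rfl fun j _ => ?_
  rw [← e2', Finset.mul_sum]
  refine Finset.sum_congr rfl fun k _ => ?_
  simp only [Pi.single_eq_same]
  ring

theorem polar_self (hf : f.IsHomogeneous 3) (x : Fin 6 → R) :
    polar f R x x x = 6 * aeval x f := by
  have h := congrArg (aeval x) hf.sum_X_mul_pderiv
  simp only [map_sum, map_mul, aeval_X, nsmul_eq_mul, map_natCast] at h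
  have hx : x = ∑ i, x i • Pi.single i (1 : R) := pi_eq_sum_univ' x
  calc polar f R x x x = polar f R x x (∑ i, x i • Pi.single i (1 : R)) := by rw [← hx]
    _ = 2 * ∑ i, x i * aeval x (pderiv i f) := by
      simp only [map_sum, map_smul, polar_self_single hf, smul_eq_mul, Finset.mul_sum]
      exact Finset.sum_congr rfl fun i _ => by ring
    _ = _ := by rw [h]; push_cast; ring

end

/-- Smoothness passes from `ℂ` to `K` by the Nullstellensatz: a power of every coordinate lies in
the Jacobian ideal, so a common zero of the partial derivatives over any `K` is the origin. -/
theorem exists_pderiv_ne_zero {f : MvPolynomial (Fin 6) ℂ} (hf : IsSmoothCubic f) {K : Type*} [Field K]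
    [Algebra ℂ K] (p : Fin 6 → K) (hp : p ≠ 0) : ∃ i, aeval p (pderiv i f) ≠ 0 := by
  by_contra! h
  obtain ⟨m, hm⟩ := Function.ne_iff.1 hp
  let I : Ideal (MvPolynomial (Fin 6) ℂ) := Ideal.span (Set.range fun i => pderiv i f)
  have hI : X m ∈ I.radical := by
    rw [← vanishingIdeal_zeroLocus_eq_radical (K := ℂ) I]
    intro v hv
    rw [aeval_X]
    by_contra hvm
    have hv0 : v ≠ 0 := fun h => hvm (by simp [h])
    have hd : ∀ i, eval v (pderiv i f) = 0 := fun i => hv _ (Ideal.subset_span ⟨i, rfl⟩)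
    have he := congrArg (eval v) hf.homogeneous.sum_X_mul_pderiv
    simp only [map_sum, map_mul, hd, mul_zero, Finset.sum_const_zero, nsmul_eq_mul] at he
    obtain ⟨i, hi⟩ := hf.smooth v hv0 (by simpa using he.symm)
    exact hi (hd i)
  obtain ⟨n, hn⟩ := hI
  have hle : I ≤ RingHom.ker (aeval (R := ℂ) p) := by
    refine Ideal.span_le.2 ?_
    rintro _ ⟨i, rfl⟩
    exact h i
  have := hle hn
  rw [RingHom.mem_ker, map_pow, aeval_X] at this
  exact hm (eq_zero_of_pow_eq_zero this)

theorem isSmoothPolar_polar {f : MvPolynomial (Fin 6) ℂ} (hf : IsSmoothCubic f) (K : Type) [Field K]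
    [Algebra ℂ K] : IsSmoothPolar (polar f K) where
  swap_left := polar_swap_left f
  swap_right := polar_swap_right f
  derivation := derivation_polar f
  smooth p hp := by
    have : CharZero K := charZero_of_injective_algebraMap (algebraMap ℂ K).injective
    obtain ⟨i, hi⟩ := exists_pderiv_ne_zero hf p hp
    exact ⟨Pi.single i 1, by rw [polar_self_single hf.homogeneous]; simpa using hi⟩

theorem map_chartMatrix {R S : Type*} [CommRing R] [CommRing S] (φ : R →+* S)
    (e : Fin 4 ⊕ Fin 2 ≃ Fin 6) (w : Fin 4 × Fin 2 → R) (i : Fin 4) :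
    φ ∘ chartMatrix e w i = chartMatrix e (φ ∘ w) i := by
  ext m
  obtain ⟨k | l, rfl⟩ := e.surjective m
  · by_cases h : i = k <;> simp [h]
  · simp

theorem map_sum_smul_chartMatrix {R S : Type*} [CommRing R] [CommRing S] (φ : R →+* S)
    (e : Fin 4 ⊕ Fin 2 ≃ Fin 6) (w : Fin 4 × Fin 2 → R) (c : Fin 4 → R) :
    φ ∘ (∑ i, c i • chartMatrix e w i) = ∑ i, (φ ∘ c) i • chartMatrix e (φ ∘ w) i := by
  ext m
  have := fun i => congrFun (map_chartMatrix φ e w i) m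
  simp only [Function.comp_apply] at this
  simp [Finset.sum_apply, this]

section
variable {f : MvPolynomial (Fin 6) ℂ}

/-- The incidence variety records the coordinates of the vertex in the rows. The index of `E` names
a coordinate scaled to `1`, which excludes the zero vector by a closed condition. -/
theorem topologicalKrullDim_cone_le (hf : IsSmoothCubic f) (S : Set Grass)
    (hS : ∀ A : Frame, A.toGrass ∈ S → ∃ c : Fin 4 → ℂ, c ≠ 0 ∧
      ∀ i j, polar f ℂ (∑ i, c i • A.1 i) (A.1 i) (A.1 j) = 0) :
    topologicalKrullDim (closure S) ≤ 4 := by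
  refine topologicalKrullDim_closure_le (d := 4) S fun e P _ hP => ?_
  let R := MvPolynomial ((Fin 4 × Fin 2) ⊕ Fin 4) ℂ
  let U := chartMatrix e (R := R) fun ij => X (Sum.inl ij)
  let p := ∑ i, (X (Sum.inr i) : R) • U i
  let E : Fin 4 → Set R := fun k =>
    insert (X (Sum.inr k) - 1) (Set.range fun ij : Fin 4 × Fin 4 => polar f R p (U ij.1) (U ij.2))
  have hE : ∀ (K : Type) [Field K] [Algebra ℂ K] (k : Fin 4) (x : Fin 4 × Fin 2 → K)
      (y : Fin 4 → K), (∀ q ∈ E k, aeval (Sum.elim x y) q = 0) ↔ y k = 1 ∧ ∀ i j,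
        polar f K (∑ i, y i • chartMatrix e x i) (chartMatrix e x i) (chartMatrix e x j) = 0 := by
    intro K _ _ k x y
    let φ : R →ₐ[ℂ] K := aeval (Sum.elim x y)
    have hU : ∀ i, φ ∘ U i = chartMatrix e x i := fun i => by
      rw [show φ ∘ U i = _ from map_chartMatrix (φ : R →+* K) e _ i]
      congr 1; ext ij; exact aeval_X (Sum.elim x y) _
    have hp : φ ∘ p = ∑ i, y i • chartMatrix e x i := by
      rw [show φ ∘ p = _ from map_sum_smul_chartMatrix (φ : R →+* K) e _ _]
      refine Finset.sum_congr rfl fun i _ => ?_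
      congr 1
      · exact aeval_X (Sum.elim x y) _
      · congr 1; ext ij; exact aeval_X (Sum.elim x y) _
    simp only [E, Set.forall_mem_insert, Set.forall_mem_range, map_sub, aeval_X, map_one,
      Sum.elim_inr, sub_eq_zero, Prod.forall]
    refine and_congr Iff.rfl (forall₂_congr fun i j => ?_)
    rw [show aeval (Sum.elim x y) _ = φ _ from rfl, map_polar, hp, hU, hU]
  refine ringKrullDim_quotient_le_of_forall_point {w | (chartFrame e w).toGrass ∈ S} E ?_ ?_ P hP
  · intro w hw
    obtain ⟨c, hc, h⟩ := hS _ hw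
    obtain ⟨k, hk⟩ := Function.ne_iff.1 hc
    refine ⟨k, (c k)⁻¹ • c, (hE ℂ k w _).2 ⟨by simpa using inv_mul_cancel₀ hk, fun i j => ?_⟩⟩
    have h1 : (∑ i, ((c k)⁻¹ • c) i • chartMatrix e w i) =
        (c k)⁻¹ • ∑ i, c i • chartMatrix e w i := by simp [Finset.smul_sum, smul_smul]
    have h2 := h i j
    simp only [chartFrame] at h2
    rw [h1, map_smul, LinearMap.smul_apply, LinearMap.smul_apply, h2, smul_zero]
  · intro K _ _ _ k x y h
    obtain ⟨h1, h2⟩ := (hE K k x y).1 h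
    exact (isSmoothPolar_polar hf K).finrank_cone_le e x y k h1 h2

theorem topologicalKrullDim_line_le (hf : IsSmoothCubic f) (S : Set Grass)
    (hS : ∀ A : Frame, A.toGrass ∈ S → ∃ a b : Fin 4 → ℂ, LinearIndependent ℂ ![a, b] ∧
      ∀ i, polar f ℂ (∑ i, a i • A.1 i) (∑ i, a i • A.1 i) (A.1 i) = 0 ∧
        polar f ℂ (∑ i, a i • A.1 i) (∑ i, b i • A.1 i) (A.1 i) = 0 ∧
        polar f ℂ (∑ i, b i • A.1 i) (∑ i, b i • A.1 i) (A.1 i) = 0) :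
    topologicalKrullDim (closure S) ≤ 4 := by
  refine topologicalKrullDim_closure_le (d := 4) S fun e P _ hP => ?_
  let R := MvPolynomial ((Fin 4 × Fin 2) ⊕ (Fin 4 ⊕ Fin 4)) ℂ
  let U := chartMatrix e (R := R) fun ij => X (Sum.inl ij)
  let p := ∑ i, (X (Sum.inr (Sum.inl i)) : R) • U i
  let q := ∑ i, (X (Sum.inr (Sum.inr i)) : R) • U i
  let E : Fin 4 × Fin 4 → Set R := fun kl =>
    {X (Sum.inr (Sum.inl kl.1)) - 1, X (Sum.inr (Sum.inl kl.2)),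
      X (Sum.inr (Sum.inr kl.1)), X (Sum.inr (Sum.inr kl.2)) - 1} ∪
    (Set.range fun i => polar f R p p (U i)) ∪ (Set.range fun i => polar f R p q (U i)) ∪
    (Set.range fun i => polar f R q q (U i))
  have hE : ∀ (K : Type) [Field K] [Algebra ℂ K] (kl : Fin 4 × Fin 4) (x : Fin 4 × Fin 2 → K)
      (y : Fin 4 ⊕ Fin 4 → K), (∀ q ∈ E kl, aeval (Sum.elim x y) q = 0) ↔
        (((y (Sum.inl kl.1) = 1 ∧ y (Sum.inl kl.2) = 0 ∧ y (Sum.inr kl.1) = 0 ∧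
          y (Sum.inr kl.2) = 1) ∧
        ∀ i, polar f K (∑ i, y (Sum.inl i) • chartMatrix e x i)
          (∑ i, y (Sum.inl i) • chartMatrix e x i) (chartMatrix e x i) = 0) ∧
        ∀ i, polar f K (∑ i, y (Sum.inl i) • chartMatrix e x i)
          (∑ i, y (Sum.inr i) • chartMatrix e x i) (chartMatrix e x i) = 0) ∧
        ∀ i, polar f K (∑ i, y (Sum.inr i) • chartMatrix e x i)
          (∑ i, y (Sum.inr i) • chartMatrix e x i) (chartMatrix e x i) = 0 := by
    intro K _ _ kl x y
    let φ : R →ₐ[ℂ] K := aeval (Sum.elim x y)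
    have hU : ∀ i, φ ∘ U i = chartMatrix e x i := fun i => by
      rw [show φ ∘ U i = _ from map_chartMatrix (φ : R →+* K) e _ i]
      congr 1; ext ij; exact aeval_X (Sum.elim x y) _
    have hpq : ∀ g : Fin 4 → Fin 4 ⊕ Fin 4, φ ∘ (∑ i, (X (Sum.inr (g i)) : R) • U i) =
        ∑ i, y (g i) • chartMatrix e x i := fun g => by
      rw [show φ ∘ (∑ i, (X (Sum.inr (g i)) : R) • U i) = _ from
        map_sum_smul_chartMatrix (φ : R →+* K) e _ _]
      refine Finset.sum_congr rfl fun i _ => ?_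
      congr 1
      · exact aeval_X (Sum.elim x y) _
      · congr 1; ext ij; exact aeval_X (Sum.elim x y) _
    simp only [E, Set.union_def, Set.mem_ofPred_eq, or_imp, forall_and, Set.forall_mem_range,
      Set.mem_insert_iff, Set.mem_singleton_iff, forall_eq]
    have hval : ∀ g h : Fin 4 → Fin 4 ⊕ Fin 4, ∀ i,
        φ (polar f R (∑ i, (X (Sum.inr (g i)) : R) • U i) (∑ i, (X (Sum.inr (h i)) : R) • U i) (U i))
        = polar f K (∑ i, y (g i) • chartMatrix e x i) (∑ i, y (h i) • chartMatrix e x i)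
          (chartMatrix e x i) := fun g h i => by rw [map_polar, hpq, hpq, hU]
    refine and_congr (and_congr (and_congr ?_ (forall_congr' fun i => ?_))
      (forall_congr' fun i => ?_)) (forall_congr' fun i => ?_)
    · simp [sub_eq_zero]
    · exact Eq.congr (hval Sum.inl Sum.inl i) rfl
    · exact Eq.congr (hval Sum.inl Sum.inr i) rfl
    · exact Eq.congr (hval Sum.inr Sum.inr i) rfl
  refine ringKrullDim_quotient_le_of_forall_point {w | (chartFrame e w).toGrass ∈ S} E ?_ ?_ P hP
  · intro w hw
    obtain ⟨a, b, hab, h⟩ := hS _ hw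
    simp only [chartFrame] at h
    -- A nonzero `2 × 2` minor allows passing to the basis `a'`, `b'` of the same plane with
    -- identity block at `k`, `l`.
    have hminor : ∃ k l, a k * b l - a l * b k ≠ 0 := by
      by_contra! h0
      rw [LinearIndependent.pair_iff] at hab
      have ha : a ≠ 0 := fun ha => one_ne_zero (hab 1 0 (by simp [ha])).1
      obtain ⟨k, hk⟩ := Function.ne_iff.1 ha
      refine hk (neg_eq_zero.1 (hab (b k) (-a k) ?_).2)
      ext l
      simp
      linear_combination -h0 k l
    obtain ⟨k, l, hkl⟩ := hminor
    let a' := (a k * b l - a l * b k)⁻¹ • (b l • a - a l • b)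
    let b' := (a k * b l - a l * b k)⁻¹ • (a k • b - b k • a)
    refine ⟨(k, l), Sum.elim a' b', (hE ℂ _ w _).2 ?_⟩
    have ha' : ∑ i, a' i • chartMatrix e w i = (a k * b l - a l * b k)⁻¹ •
        (b l • ∑ i, a i • chartMatrix e w i - a l • ∑ i, b i • chartMatrix e w i) := by
      simp [a', Finset.smul_sum, smul_sub, sub_smul, smul_smul, mul_assoc]
    have hb' : ∑ i, b' i • chartMatrix e w i = (a k * b l - a l * b k)⁻¹ •
        (a k • ∑ i, b i • chartMatrix e w i - b k • ∑ i, a i • chartMatrix e w i) := by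
      simp [b', Finset.smul_sum, smul_sub, sub_smul, smul_smul, mul_assoc]
    simp only [Sum.elim_inl, Sum.elim_inr, ha', hb']
    have h3 : ∀ i, polar f ℂ (∑ i, b i • chartMatrix e w i) (∑ i, a i • chartMatrix e w i)
        (chartMatrix e w i) = 0 := fun i => by rw [polar_swap_left]; exact (h i).2.1
    refine ⟨⟨⟨⟨?_, ?_, ?_, ?_⟩, ?_⟩, ?_⟩, ?_⟩
    · simp [a']; field_simp
    · simp [a']; right; ring
    · simp [b']; right; ring
    · simp [b']; field_simp
    all_goals
      intro i
      simp only [map_smul, map_sub, LinearMap.smul_apply, LinearMap.sub_apply, (h i).1, (h i).2.1,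
        (h i).2.2, h3]
      simp
  · intro K _ _ _ kl x y h
    obtain ⟨⟨⟨⟨h1, h2, h3, h4⟩, h5⟩, h6⟩, h7⟩ := (hE K kl x y).1 h
    exact (isSmoothPolar_polar hf K).finrank_line_le e x _ _ kl.1 kl.2 h1 h2 h3 h4 h5 h6 h7

end

/-! ### Restriction to the 3-space and the vertex of a cone -/

/-- Restriction of polynomials to the row space of `A`. -/
noncomputable def Frame.restrict (A : Frame) :
    MvPolynomial (Fin 6) ℂ →ₐ[ℂ] MvPolynomial (Fin 4) ℂ :=
  aeval fun j => ∑ r, C (A.1 r j) * X r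

theorem Frame.eval_restrict (A : Frame) (p : MvPolynomial (Fin 6) ℂ) (x : Fin 4 → ℂ) :
    eval x (A.restrict p) = eval (∑ r, x r • A.1 r) p := by
  have : (aeval (R := ℂ) x).comp A.restrict = aeval (∑ r, x r • A.1 r) := by
    ext j
    simp [Frame.restrict, Finset.sum_apply, mul_comm]
  exact congrArg (fun φ => φ p) this

theorem Frame.restrict_linearForm (A : Frame) (a : Fin 6 → ℂ) :
    A.restrict (linearForm a) = ∑ r, C (A.1.mulVec a r) * X r := by
  simp only [linearForm, Frame.restrict, map_sum, map_mul, aeval_X, algHom_C, algebraMap_eq,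
    Finset.mul_sum, Matrix.mulVec, dotProduct, Finset.sum_mul]
  rw [Finset.sum_comm]
  exact Finset.sum_congr rfl fun _ _ => Finset.sum_congr rfl fun _ _ => by ring

theorem Frame.isHomogeneous_restrict (A : Frame) {p : MvPolynomial (Fin 6) ℂ} {n : ℕ}
    (hp : p.IsHomogeneous n) : (A.restrict p).IsHomogeneous n := by
  have := hp.aeval (S := ℂ) (fun j => ∑ r, C (A.1 r j) * X r) (n := 1) fun j =>
    IsHomogeneous.sum _ _ _ fun r _ => isHomogeneous_C_mul_X _ _
  rwa [one_mul] at this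

theorem Frame.mem_toGrass (A : Frame) (a : Fin 6 → ℂ) :
    a ∈ A.toGrass.toSubmodule ↔ A.1.mulVec a = 0 := Iff.rfl

theorem Frame.sectionIdeal_le_comap (A : Frame) (f : MvPolynomial (Fin 6) ℂ) :
    sectionIdeal f A.toGrass ≤ (Ideal.span {A.restrict f}).comap A.restrict := by
  refine Ideal.span_le.2 ?_
  rintro _ (rfl | ⟨a, ha, rfl⟩)
  · exact Ideal.subset_span rfl
  · rw [SetLike.mem_coe, Ideal.mem_comap, A.restrict_linearForm, (A.mem_toGrass a).1 ha]
    simp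

theorem Frame.restrict_surjective (A : Frame) : Function.Surjective A.restrict := by
  obtain ⟨B, hB⟩ := Matrix.mulVec_surjective_iff_exists_right_inverse.1 A.2
  refine fun p => ⟨aeval (fun r => linearForm fun j => B j r) p, ?_⟩
  have : A.restrict.comp (aeval (R := ℂ) fun r => linearForm fun j => B j r) = AlgHom.id ℂ _ := by
    ext r : 1
    have h : A.1.mulVec (fun j => B j r) = Pi.single r 1 := by
      ext i
      have := congrFun (congrFun hB i) r
      simpa [Matrix.mul_apply, Matrix.one_apply, Pi.single_apply, Matrix.mulVec, dotProduct] using this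
    simp [A.restrict_linearForm, h, Pi.single_apply]
  exact congrArg (fun φ => φ p) this

/-- A right inverse of the matrix lifts the four coordinates back to linear forms. Each variable
agrees with the lift of its restriction modulo linear forms in the kernel, hence so does every
polynomial. -/
theorem Frame.ker_restrict_le (A : Frame) : RingHom.ker A.restrict ≤
    Ideal.span (linearForm '' (A.toGrass.toSubmodule : Set (Fin 6 → ℂ))) := by
  obtain ⟨B, hB⟩ := Matrix.mulVec_surjective_iff_exists_right_inverse.1 A.2
  set I := Ideal.span (linearForm '' (A.toGrass.toSubmodule : Set (Fin 6 → ℂ)))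
  have : (Ideal.Quotient.mkₐ ℂ I).comp
      ((aeval (R := ℂ) fun r => linearForm fun j => B j r).comp A.restrict) =
      Ideal.Quotient.mkₐ ℂ I := by
    ext j : 1
    refine (Ideal.Quotient.eq.2 ?_).symm
    refine Ideal.subset_span ⟨Pi.single j 1 - (B * A.1).mulVec (Pi.single j 1), ?_, ?_⟩
    · rw [SetLike.mem_coe, A.mem_toGrass, Matrix.mulVec_sub, Matrix.mulVec_mulVec, ← Matrix.mul_assoc, hB,
        Matrix.one_mul, sub_self]
    · have h1 : ((aeval (R := ℂ) fun r => linearForm fun j => B j r).comp A.restrict) (X j) =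
          ∑ r, C (A.1 r j) * linearForm fun j => B j r := by
        simp [Frame.restrict]
      change _ = X j - ((aeval (R := ℂ) fun r => linearForm fun j => B j r).comp A.restrict) (X j)
      rw [h1]
      simp only [linearForm, Pi.sub_apply, map_sub, sub_mul, Finset.sum_sub_distrib,
        Finset.mul_sum]
      congr 1
      · simp [Pi.single_apply]
      · rw [Finset.sum_comm]
        refine Finset.sum_congr rfl fun i _ => ?_
        simp only [Matrix.mulVec_single_one, Matrix.col_apply, Matrix.mul_apply, map_sum, map_mul,
          Finset.sum_mul]
        exact Finset.sum_congr rfl fun r _ => by ring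
  intro p hp
  have h := congrArg (fun φ => φ p) this
  simp only [AlgHom.comp_apply, (RingHom.mem_ker).1 hp, map_zero] at h
  exact Ideal.Quotient.eq_zero_iff_mem.1 h.symm

theorem Frame.sectionIdeal_eq_comap (A : Frame) (f : MvPolynomial (Fin 6) ℂ) :
    sectionIdeal f A.toGrass = (Ideal.span {A.restrict f}).comap A.restrict := by
  refine (A.sectionIdeal_le_comap f).antisymm fun p hp => ?_
  obtain ⟨q, hq⟩ := Ideal.mem_span_singleton.1 (Ideal.mem_comap.1 hp)
  obtain ⟨q, rfl⟩ := A.restrict_surjective q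
  have h1 : p - f * q ∈ RingHom.ker A.restrict := by
    rw [RingHom.mem_ker, map_sub, hq, map_mul, sub_self]
  have h2 : p - f * q ∈ sectionIdeal f A.toGrass :=
    Ideal.span_mono (Set.subset_insert _ _) (A.ker_restrict_le h1)
  have h3 : f * q ∈ sectionIdeal f A.toGrass :=
    Ideal.mul_mem_right _ _ (Ideal.subset_span (Set.mem_insert _ _))
  simpa using add_mem h2 h3

theorem polar_self_eval {f : MvPolynomial (Fin 6) ℂ} (hf : f.IsHomogeneous 3) (x : Fin 6 → ℂ) :
    polar f ℂ x x x = 6 * eval x f := polar_self hf x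

theorem polar_cube_add_smul (f : MvPolynomial (Fin 6) ℂ) {R : Type*} [CommRing R] [Algebra ℂ R]
    (z p : Fin 6 → R) (s : R) :
    polar f R (z + s • p) (z + s • p) (z + s • p) = polar f R z z z + 3 * s * polar f R p z z +
      3 * s ^ 2 * polar f R p p z + s ^ 3 * polar f R p p p := by
  simp only [map_add, map_smul, LinearMap.add_apply, LinearMap.smul_apply, smul_eq_mul]
  rw [polar_swap_right f z z p, polar_swap_left f z p z, polar_swap_right f p z p,
    polar_swap_left f z p p, polar_swap_right f p z p]
  ring

/-- Three linear forms on a four-space have a common zero `c`. The equation of the cone, and with it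
its unit multiple `A.restrict f`, is invariant under translation by `c`. The terms of `f (z + s p)`
linear in `s` therefore vanish, and polarization in `z` gives the claim. -/
theorem exists_vertex {f : MvPolynomial (Fin 6) ℂ} (hf : f.IsHomogeneous 3) (A : Frame)
    (h : IsSimpleEllipticSection f A.toGrass) : ∃ c : Fin 4 → ℂ, c ≠ 0 ∧
      ∀ i j, polar f ℂ (∑ i, c i • A.1 i) (A.1 i) (A.1 j) = 0 := by
  obtain ⟨y, g, -, -, hI⟩ := h
  obtain ⟨c, hc, hcy⟩ : ∃ c : Fin 4 → ℂ, c ≠ 0 ∧ ∀ j, ∑ r, A.1.mulVec (y j) r * c r = 0 := by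
    let T : (Fin 4 → ℂ) →ₗ[ℂ] (Fin 3 → ℂ) := (Matrix.of fun j r => A.1.mulVec (y j) r).mulVecLin
    have hT : LinearMap.ker T ≠ ⊥ := LinearMap.ker_ne_bot_of_finrank_lt (by simp)
    obtain ⟨c, hc, hc0⟩ := Submodule.exists_mem_ne_zero_of_ne_bot hT
    exact ⟨c, hc0, fun j => congrFun (LinearMap.mem_ker.1 hc) j⟩
  refine ⟨c, hc, ?_⟩
  set p := ∑ i, c i • A.1 i with hp
  let h := aeval (fun j => linearForm (y j)) g
  have hinv : ∀ (x : Fin 4 → ℂ) (s : ℂ), eval (x + s • c) (A.restrict h) = eval x (A.restrict h) := by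
    intro x s
    have h1 : ∀ x, eval x (A.restrict h) = eval (fun j => ∑ r, A.1.mulVec (y j) r * x r) g := by
      intro x
      have : (aeval (R := ℂ) x).comp (A.restrict.comp (aeval fun j => linearForm (y j))) =
          aeval fun j => ∑ r, A.1.mulVec (y j) r * x r := by
        ext j
        simp [A.restrict_linearForm]
      exact congrArg (fun φ => φ g) this
    rw [h1, h1]
    congr 2
    ext j
    have := hcy j
    simp only [Pi.add_apply, Pi.smul_apply, smul_eq_mul, mul_add, Finset.sum_add_distrib]
    rw [add_eq_left]
    simp only [mul_left_comm _ s, ← Finset.mul_sum, this, mul_zero]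
  have hspan : Ideal.span {A.restrict f} = Ideal.span {A.restrict h} := by
    rw [A.sectionIdeal_eq_comap, A.sectionIdeal_eq_comap] at hI
    exact Ideal.comap_injective_of_surjective _ A.restrict_surjective hI
  obtain ⟨u, hu⟩ := Ideal.span_singleton_eq_span_singleton.1 hspan.symm
  obtain ⟨r, -, hr⟩ := isUnit_iff_eq_C_of_isReduced.1 u.isUnit
  have hfinv : ∀ (x : Fin 4 → ℂ) (s : ℂ),
      eval (x + s • c) (A.restrict f) = eval x (A.restrict f) := by
    intro x s
    rw [← hu, hr, map_mul, map_mul, hinv, eval_C, eval_C]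
  have hdiag : ∀ x : Fin 4 → ℂ, polar f ℂ p (∑ i, x i • A.1 i) (∑ i, x i • A.1 i) = 0 := by
    intro x
    set z := ∑ i, x i • A.1 i with hz
    have key : ∀ s : ℂ, 3 * s * polar f ℂ p z z + 3 * s ^ 2 * polar f ℂ p p z +
        s ^ 3 * polar f ℂ p p p = 0 := by
      intro s
      have h1 := hfinv x s
      rw [A.eval_restrict, A.eval_restrict] at h1
      have h2 : ∑ r, (x + s • c) r • A.1 r = z + s • p := by
        simp [hz, hp, add_smul, Finset.sum_add_distrib, Finset.smul_sum, smul_smul]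
      rw [h2, ← hz] at h1
      have h3 := polar_cube_add_smul f z p s
      rw [polar_self_eval hf, polar_self_eval hf, h1] at h3
      linear_combination -h3
    have k1 := key 1
    have k2 := key (-1)
    have k3 := key 2
    -- The weights eliminate the quadratic and cubic terms in `s`.
    linear_combination k1 / 3 - k2 / 9 - k3 / 18
  intro i j
  have hs : ∀ i : Fin 4, ∑ k, (Pi.single i (1 : ℂ) : Fin 4 → ℂ) k • A.1 k = A.1 i := fun i => by
    rw [Finset.sum_eq_single i (fun k _ h => by simp [h]) (by simp)]
    simp
  have e1 := hdiag (Pi.single i 1)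
  have e2 := hdiag (Pi.single j 1)
  have e3 := hdiag (Pi.single i 1 + Pi.single j 1)
  simp only [Pi.add_apply, add_smul, Finset.sum_add_distrib, hs] at e1 e2 e3
  simp only [map_add, LinearMap.add_apply, e1, e2] at e3
  rw [polar_swap_right f p (A.1 j)] at e3
  linear_combination e3 / 2

theorem topologicalKrullDim_simpleElliptic_le {f : MvPolynomial (Fin 6) ℂ} (hf : IsSmoothCubic f) :
    topologicalKrullDim (closure {N : Grass | IsSimpleEllipticSection f N}) ≤ 4 :=
  topologicalKrullDim_cone_le hf _ fun A hA => exists_vertex hf.homogeneous A hA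

end CubicFourfold

/-! ### Integral closure of a simple extension -/

open Polynomial in
/-- The derivative of an equation of a primitive element conducts the integral closure. -/
theorem exists_algebraMap_eq_derivative_mul {A R L : Type*} [CommRing A] [IsDomain A]
    [IsIntegrallyClosed A] [CharZero A] [CommRing R] [IsDomain R] [Algebra A R] [FaithfulSMul A R]
    [Field L] [Algebra R L] [IsFractionRing R L] {θ : R} (hθ : IsIntegral A θ)
    (htop : Algebra.adjoin A {θ} = ⊤) {b : L} (hb : IsIntegral R b) (Q : A[X])
    (hQ : aeval θ Q = 0) :
    ∃ r, algebraMap R L r = algebraMap R L (aeval θ (derivative Q)) * b := by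
  let K := FractionRing A
  let : Algebra A L := ((algebraMap R L).comp (algebraMap A R)).toAlgebra
  have : IsScalarTower A R L := IsScalarTower.of_algebraMap_eq fun _ => rfl
  have hinj : Function.Injective (algebraMap A L) :=
    (IsFractionRing.injective R L).comp (FaithfulSMul.algebraMap_injective A R)
  have : FaithfulSMul A L := (faithfulSMul_iff_algebraMap_injective A L).2 hinj
  let : Algebra K L := FractionRing.liftAlgebra A L
  have : IsScalarTower A K L := FractionRing.isScalarTower_liftAlgebra A L
  have : CharZero K := charZero_of_injective_algebraMap (IsFractionRing.injective A K)
  set x : L := algebraMap R L θ with hx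
  have hxA : IsIntegral A x := hθ.algebraMap
  have hR : ∀ y : R, ∃ p : A[X], aeval θ p = y := fun y => by
    have : y ∈ Algebra.adjoin A {θ} := htop ▸ Algebra.mem_top
    rwa [Algebra.adjoin_singleton_eq_range_aeval] at this
  have hmem : ∀ y : R, algebraMap R L y ∈ Algebra.adjoin A {x} := fun y => by
    obtain ⟨p, rfl⟩ := hR y
    rw [Algebra.adjoin_singleton_eq_range_aeval]
    exact ⟨p, by rw [hx]; exact aeval_algebraMap_apply L θ p⟩
  have hmem' : ∀ y ∈ Algebra.adjoin A {x}, ∃ r, algebraMap R L r = y := fun y hy => by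
    rw [Algebra.adjoin_singleton_eq_range_aeval] at hy
    obtain ⟨p, rfl⟩ := hy
    exact ⟨aeval θ p, by rw [hx]; exact (aeval_algebraMap_apply L θ p).symm⟩
  have hKx : IsIntegral K x := hxA.tower_top
  have hKtop : Algebra.adjoin K {x} = ⊤ := by
    rw [eq_top_iff]
    rintro y -
    have hle : ∀ z ∈ Algebra.adjoin A {x}, z ∈ Algebra.adjoin K {x} := fun z hz => by
      have : Algebra.adjoin A {x} ≤ (Algebra.adjoin K {x}).restrictScalars A :=
        Algebra.adjoin_le (by simp)
      exact this hz
    obtain ⟨r, s, hs, rfl⟩ := IsFractionRing.div_surjective (A := R) y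
    rw [div_eq_mul_inv]
    refine mul_mem (hle _ (hmem r)) ?_
    have := Algebra.IsIntegral.adjoin (R := K) (S := {x}) (by simpa using hKx)
    refine Subalgebra.inv_mem_of_algebraic _ (x := ⟨_, hle _ (hmem s)⟩) ?_
    exact (IsIntegral.isAlgebraic ((this.isIntegral ⟨_, hle _ (hmem s)⟩).map (Subalgebra.val _)))
  have hfin : FiniteDimensional K L := by
    have : (Algebra.adjoin K {x}).toSubmodule.FG := hKx.fg_adjoin_singleton
    rw [hKtop, Algebra.top_toSubmodule] at this
    exact ⟨this⟩
  have hRint : Algebra.IsIntegral A R := ⟨fun y => by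
    have := Algebra.IsIntegral.adjoin (R := A) (S := {θ}) (by simpa using hθ)
    rw [htop] at this
    exact (this.isIntegral ⟨y, Algebra.mem_top⟩).map (Subalgebra.val _)⟩
  have hbA : IsIntegral A b := isIntegral_trans b hb
  -- Traces of integral elements lie in `A`, so `b` is in the trace dual of `A[x]`. By Euler's
  -- formula that dual is `A[x]` divided by the derivative of the minimal polynomial at `x`.
  have hdual : b ∈ (Algebra.traceForm K L).dualSubmodule
      (Subalgebra.toSubmodule (Algebra.adjoin A {x})) := by
    intro y hy
    obtain ⟨r, rfl⟩ := hmem' y hy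
    rw [Algebra.traceForm_apply, Submodule.mem_one]
    exact IsIntegrallyClosed.isIntegral_iff.1
      (Algebra.isIntegral_trace (hbA.mul (hRint.isIntegral r).algebraMap))
  rw [traceForm_dualSubmodule_adjoin A K hKtop hxA] at hdual
  obtain ⟨c, hc, hcb⟩ := hdual
  obtain ⟨r, rfl⟩ := hmem' c hc
  have hsep : aeval x (derivative (minpoly K x)) ≠ 0 :=
    (Algebra.IsSeparable.isSeparable K x).aeval_derivative_ne_zero (minpoly.aeval K x)
  -- Since `Q` is a multiple of the minimal polynomial, its derivative at `θ` is a multiple of that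
  -- of the minimal polynomial.
  obtain ⟨P, rfl⟩ : minpoly A x ∣ Q := minpoly.isIntegrallyClosed_dvd hxA (by
    rw [hx, aeval_algebraMap_apply, hQ, map_zero])
  have hM : aeval θ (minpoly A x) = 0 := IsFractionRing.injective R L (by
    rw [map_zero, ← aeval_algebraMap_apply]; exact minpoly.aeval A x)
  refine ⟨aeval θ P * r, ?_⟩
  rw [derivative_mul, map_add, map_mul, map_mul, map_mul, hM, zero_mul, add_zero,
    map_mul, ← hcb]
  have h2 : algebraMap R L (aeval θ (derivative (minpoly A x))) =
      aeval x (derivative (minpoly K x)) := by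
    rw [← aeval_algebraMap_apply, ← hx, minpoly.isIntegrallyClosed_eq_field_fractions' K hxA,
      derivative_map, aeval_map_algebraMap]
  rw [h2]
  simp only [DistribSMul.toLinearMap_apply, smul_eq_mul]
  field_simp

/-- `R` is free over `A` on powers of `θ`, so `c₂ r₁ = c₁ r₂` forces `c₁` to divide every coordinate
of `r₁`. This is the depth-two half of the normality criterion. -/
theorem exists_algebraMap_eq_of_isRelPrime {A R L : Type*} [CommRing A] [IsDomain A]
    [IsIntegrallyClosed A] [DecompositionMonoid A] [CommRing R] [IsDomain R] [Algebra A R]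
    [FaithfulSMul A R]
    [Field L] [Algebra R L] [IsFractionRing R L] {θ : R} (hθ : IsIntegral A θ)
    (htop : Algebra.adjoin A {θ} = ⊤) {b : L} {c₁ c₂ : A} (hc : IsRelPrime c₁ c₂) (h0 : c₁ ≠ 0)
    {r₁ r₂ : R} (h₁ : algebraMap R L r₁ = algebraMap R L (algebraMap A R c₁) * b)
    (h₂ : algebraMap R L r₂ = algebraMap R L (algebraMap A R c₂) * b) :
    ∃ r, algebraMap R L r = b := by
  let pb := (Algebra.adjoin.powerBasis' hθ).map
    ((Subalgebra.equivOfEq _ _ htop).trans Subalgebra.topEquiv)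
  have h : c₂ • r₁ = c₁ • r₂ := IsFractionRing.injective R L (by
    rw [Algebra.smul_def, Algebra.smul_def, map_mul, map_mul, h₁, h₂]; ring)
  have hdvd : ∀ i, c₁ ∣ pb.basis.repr r₁ i := fun i => by
    refine hc.dvd_of_dvd_mul_left (y := c₂) ?_
    have := congrArg (fun y => pb.basis.repr y i) h
    simp only [map_smul, Finsupp.smul_apply, smul_eq_mul] at this
    exact ⟨_, this⟩
  choose q hq using hdvd
  refine ⟨∑ i, q i • pb.basis i, ?_⟩
  have hr : r₁ = c₁ • ∑ i, q i • pb.basis i := by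
    conv_lhs => rw [← pb.basis.sum_repr r₁]
    simp only [Finset.smul_sum, smul_smul, hq]
  have hne : algebraMap R L (algebraMap A R c₁) ≠ 0 := by
    simpa using h0
  refine mul_left_cancel₀ hne ?_
  rw [← h₁, hr, Algebra.smul_def, map_mul]

/-! ### Singular points and double lines of an integral cubic surface -/

namespace CubicFourfold
open MvPolynomial

/-- The four-dimensional space spanned by the rows of a frame. -/
def Frame.rowSpace (A : Frame) : Submodule ℂ (Fin 6 → ℂ) := Submodule.span ℂ (Set.range A.1)

theorem Frame.linearIndependent (A : Frame) : LinearIndependent ℂ A.1 := by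
  obtain ⟨B, hB⟩ := Matrix.mulVec_surjective_iff_exists_right_inverse.1 A.2
  refine Matrix.vecMul_injective_iff.1 fun x y h => ?_
  have := congrArg (fun z => Matrix.vecMul z B) h
  simpa [Matrix.vecMul_vecMul, hB] using this

theorem Frame.finrank_rowSpace (A : Frame) : Module.finrank ℂ A.rowSpace = 4 := by
  rw [Frame.rowSpace, finrank_span_eq_card A.linearIndependent, Fintype.card_fin]

theorem Frame.mem_rowSpace {A : Frame} {z : Fin 6 → ℂ} :
    z ∈ A.rowSpace ↔ ∃ x : Fin 4 → ℂ, ∑ r, x r • A.1 r = z :=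
  Submodule.mem_span_range_iff_exists_fun ℂ

theorem Frame.mem_rowSpace_iff {A : Frame} {z : Fin 6 → ℂ} :
    z ∈ A.rowSpace ↔ ∀ a ∈ A.toGrass.toSubmodule, a ⬝ᵥ z = 0 := by
  rw [Frame.mem_rowSpace]
  constructor
  · rintro ⟨x, rfl⟩ a ha
    have h : ∀ r, A.1 r ⬝ᵥ a = 0 := fun r => congrFun ((A.mem_toGrass a).1 ha) r
    rw [dotProduct_comm]
    simp [sum_dotProduct, h]
  · intro h
    obtain ⟨B, hB⟩ := Matrix.mulVec_surjective_iff_exists_right_inverse.1 A.2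
    refine ⟨Matrix.vecMul z B, ?_⟩
    ext j
    have := h (Pi.single j 1 - (B * A.1).mulVec (Pi.single j 1)) (by
      rw [A.mem_toGrass, Matrix.mulVec_sub, Matrix.mulVec_mulVec, ← Matrix.mul_assoc, hB,
        Matrix.one_mul, sub_self])
    rw [sub_dotProduct, single_one_dotProduct, sub_eq_zero, dotProduct_comm,
      Matrix.dotProduct_mulVec, dotProduct_single_one, ← Matrix.vecMul_vecMul] at this
    rw [this]
    simp [Matrix.vecMul, dotProduct]

theorem Frame.rowSpace_congr {A B : Frame} (h : A.toGrass = B.toGrass) :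
    A.rowSpace = B.rowSpace := by
  ext z
  rw [Frame.mem_rowSpace_iff, Frame.mem_rowSpace_iff, h]

theorem Frame.exists_of_linearIndependent (A : Frame) {v : Fin 4 → Fin 6 → ℂ}
    (hv : LinearIndependent ℂ v) (h : ∀ r, v r ∈ A.rowSpace) :
    ∃ B : Frame, B.1 = v ∧ B.toGrass = A.toGrass := by
  choose g hg using fun r => Frame.mem_rowSpace.1 (h r)
  have hgA : Matrix.of v = Matrix.of g * A.1 := by
    ext r j
    simp [← hg, Matrix.mul_apply, Finset.sum_apply]
  have hgu : IsUnit (Matrix.of g) := by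
    refine Matrix.vecMul_injective_iff_isUnit.1 fun x y hxy => ?_
    refine Matrix.vecMul_injective_iff.2 (show LinearIndependent ℂ (Matrix.of v).row from hv) ?_
    simp only [hgA, ← Matrix.vecMul_vecMul]
    exact congrArg (fun z => Matrix.vecMul z A.1) hxy
  have hdet := (Matrix.isUnit_iff_isUnit_det _).1 hgu
  refine ⟨⟨Matrix.of v, ?_⟩, rfl, ((Frame.toGrass_eq_iff _ _).2 ⟨Matrix.of g, hdet, hgA⟩).symm⟩
  rw [hgA, Matrix.mulVecLin_mul]
  exact (Matrix.mulVec_surjective_iff_isUnit.2 hgu).comp A.2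

theorem Frame.restrict_eq_zero_iff (A : Frame) (p : MvPolynomial (Fin 6) ℂ) :
    A.restrict p = 0 ↔ ∀ z ∈ A.rowSpace, eval z p = 0 := by
  constructor
  · rintro h z hz
    obtain ⟨x, rfl⟩ := Frame.mem_rowSpace.1 hz
    rw [← A.eval_restrict, h, map_zero]
  · intro h
    refine MvPolynomial.funext fun x => ?_
    rw [A.eval_restrict, map_zero]
    exact h _ (Frame.mem_rowSpace.2 ⟨x, rfl⟩)

theorem Frame.isPrime_restrict (A : Frame) {f : MvPolynomial (Fin 6) ℂ}
    (hI : IsIntegralSection f A.toGrass) : (Ideal.span {A.restrict f}).IsPrime := by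
  rw [IsIntegralSection, A.sectionIdeal_eq_comap] at hI
  have := Ideal.map_isPrime_of_surjective (f := A.restrict) A.restrict_surjective
    (I := (Ideal.span {A.restrict f}).comap A.restrict) fun p hp => by
      rw [Ideal.mem_comap, (RingHom.mem_ker).1 hp]; exact zero_mem _
  rwa [Ideal.map_comap_of_surjective _ A.restrict_surjective] at this

theorem X_dvd_of_eval_eq_zero {σ : Type*} [DecidableEq σ] [Finite σ] {g : MvPolynomial σ ℂ} (i : σ)
    (h : ∀ x : σ → ℂ, x i = 0 → eval x g = 0) : X i ∣ g := by
  let τ : MvPolynomial σ ℂ →ₐ[ℂ] MvPolynomial σ ℂ := aeval (Function.update X i 0)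
  have hτ : τ g = 0 := MvPolynomial.funext fun x => by
    have : (aeval (R := ℂ) x).comp τ = aeval (Function.update x i 0) := by
      ext j
      by_cases hj : j = i
      · subst hj; simp [τ]
      · simp [τ, hj]
    rw [map_zero]
    refine (congrArg (fun φ => φ g) this).trans ?_
    exact h _ (by simp)
  have : (Ideal.Quotient.mkₐ ℂ (Ideal.span {X i})).comp τ =
      Ideal.Quotient.mkₐ ℂ (Ideal.span {(X i : MvPolynomial σ ℂ)}) := by
    ext j
    by_cases hj : j = i
    · subst hj
      simp [τ]
    · simp [τ, hj]
  have := congrArg (fun φ => φ g) this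
  simp only [AlgHom.comp_apply, hτ, map_zero] at this
  exact Ideal.mem_span_singleton.1 (Ideal.Quotient.eq_zero_iff_mem.1 this.symm)

/-- If the cubic vanished on the plane spanned by `v`, then after completing `v` to a basis the last
coordinate would divide the restricted form, a prime of degree three. -/
theorem Frame.exists_eval_ne_zero (A : Frame) {f : MvPolynomial (Fin 6) ℂ} (hf : f.IsHomogeneous 3)
    (hI : IsIntegralSection f A.toGrass) (h0 : A.restrict f ≠ 0) {v : Fin 3 → Fin 6 → ℂ}
    (hv : LinearIndependent ℂ v) (hvW : ∀ i, v i ∈ A.rowSpace) :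
    ∃ x : Fin 3 → ℂ, eval (∑ i, x i • v i) f ≠ 0 := by
  obtain ⟨u, huW, hu⟩ : ∃ u ∈ A.rowSpace, u ∉ Submodule.span ℂ (Set.range v) := by
    by_contra! h
    have := Submodule.finrank_mono (show A.rowSpace ≤ Submodule.span ℂ (Set.range v) from h)
    rw [A.finrank_rowSpace, finrank_span_eq_card hv] at this
    simp at this
  obtain ⟨B, hB, hBA⟩ := A.exists_of_linearIndependent (v := Fin.snoc v u)
    (hv.finSnoc hu) (fun r => by
      refine Fin.lastCases ?_ (fun i => ?_) r
      · rwa [Fin.snoc_last]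
      · rw [Fin.snoc_castSucc]; exact hvW i)
  have hg0 : B.restrict f ≠ 0 := by
    rwa [Ne, B.restrict_eq_zero_iff, Frame.rowSpace_congr hBA, ← A.restrict_eq_zero_iff]
  have hprime := B.isPrime_restrict (f := f) (hBA ▸ hI)
  rw [Ideal.span_singleton_prime hg0] at hprime
  by_contra! h
  obtain ⟨r, hr⟩ := X_dvd_of_eval_eq_zero (g := B.restrict f) (3 : Fin 4) fun x hx => by
    rw [B.eval_restrict, hB, Fin.sum_univ_castSucc, show Fin.last 3 = 3 from rfl, hx, zero_smul, add_zero]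
    simpa using h fun i => x i.castSucc
  have hd := (B.isHomogeneous_restrict hf).totalDegree hg0
  rcases hprime.irreducible.isUnit_or_isUnit hr with h1 | h1
  · simpa using h1.map (eval (0 : Fin 4 → ℂ))
  · obtain ⟨c, -, hc⟩ := isUnit_iff_eq_C_of_isReduced.1 h1
    rw [hr, hc] at hd
    have := totalDegree_mul (X (3 : Fin 4)) (C c : MvPolynomial (Fin 4) ℂ)
    rw [totalDegree_X, totalDegree_C, hd] at this
    omega

/-- Assume that no two of the singular points span a double line. Then no three are collinear, and
by `H` the first four are not coplanar. In the basis they form, the cubic is a sum of squarefree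
monomials with nonzero coefficients, a Cayley cubic, which has no fifth singular point. -/
theorem exists_line_of_five {V : Type*} [AddCommGroup V] [Module ℂ V]
    (G : V →ₗ[ℂ] V →ₗ[ℂ] V →ₗ[ℂ] ℂ) (hl : ∀ u v w, G u v w = G v u w)
    (hr : ∀ u v w, G u v w = G u w v) (W : Submodule ℂ V) (hW : Module.finrank ℂ W = 4)
    (H : ∀ v : Fin 3 → V, LinearIndependent ℂ v → (∀ i, v i ∈ W) →
      (∀ i, ∀ w ∈ W, G (v i) (v i) w = 0) → G (v 0) (v 1) (v 2) ≠ 0)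
    (v : Fin 5 → V) (hvW : ∀ i, v i ∈ W) (hs : ∀ i, ∀ w ∈ W, G (v i) (v i) w = 0)
    (hp : ∀ i j, i ≠ j → LinearIndependent ℂ ![v i, v j]) :
    ∃ i j, i ≠ j ∧ ∀ w ∈ W, G (v i) (v j) w = 0 := by
  by_contra! hne
  have hs' : ∀ i, ∀ w ∈ W, G (v i) w (v i) = 0 := fun i w hw => by rw [← hr, hs i w hw]
  have hs'' : ∀ i, ∀ w ∈ W, G w (v i) (v i) = 0 := fun i w hw => by rw [hl, hs' i w hw]
  have hpair : ∀ i j, i ≠ j → ∀ s : ℂ, v i ≠ s • v j := fun i j hij s h => by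
    have := LinearIndependent.pair_iff.1 (hp i j hij) 1 (-s) (by rw [h]; simp)
    exact one_ne_zero this.1
  have h3 : ∀ i j k, i ≠ j → i ≠ k → j ≠ k → LinearIndependent ℂ ![v i, v j, v k] := by
    intro i j k hij hik hjk
    refine linearIndependent_finCons.2 ⟨hp j k hjk, fun h => ?_⟩
    rw [Matrix.range_cons, Matrix.range_cons, Matrix.range_empty, Set.union_empty,
      Set.singleton_union, Submodule.mem_span_pair] at h
    obtain ⟨s, t, h⟩ := h
    obtain ⟨w, hw, hw0⟩ := hne j k hjk
    have e := hs i w hw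
    rw [← h] at e
    simp only [map_add, map_smul, LinearMap.add_apply, LinearMap.smul_apply, smul_eq_mul,
      hs j w hw, hs k w hw, hl (v k) (v j)] at e
    have : s * t = 0 := by
      refine (mul_eq_zero.1 (?_ : (s * t) * G (v j) (v k) w = 0)).resolve_right hw0
      linear_combination e / 2
    rcases mul_eq_zero.1 this with rfl | rfl
    · exact hpair i k hik t (by rw [← h]; simp)
    · exact hpair i j hij s (by rw [← h]; simp)
  have hG : ∀ i j k, i ≠ j → i ≠ k → j ≠ k → G (v i) (v j) (v k) ≠ 0 := fun i j k hij hik hjk =>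
    H _ (h3 i j k hij hik hjk) (fun a => by fin_cases a <;> simp [hvW])
      (fun a w hw => by fin_cases a <;> simp [hs _ w hw])
  have perm : ∀ i j k, G (v i) (v k) (v j) = G (v i) (v j) (v k) ∧
      G (v j) (v i) (v k) = G (v i) (v j) (v k) ∧ G (v j) (v k) (v i) = G (v i) (v j) (v k) ∧
      G (v k) (v i) (v j) = G (v i) (v j) (v k) ∧ G (v k) (v j) (v i) = G (v i) (v j) (v k) :=
    fun i j k => ⟨hr _ _ _, hl _ _ _, by rw [hr, hl], by rw [hl, hr], by rw [hl, hr, hl]⟩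
  have h4 : LinearIndependent ℂ ![v 0, v 1, v 2, v 3] := by
    refine linearIndependent_finCons.2 ⟨h3 1 2 3 (by decide) (by decide) (by decide), fun h => ?_⟩
    rw [Matrix.range_cons, Matrix.range_cons, Matrix.range_cons, Matrix.range_empty,
      Set.union_empty, Set.singleton_union, Set.singleton_union, Submodule.mem_span_triple] at h
    obtain ⟨r, s, t, h⟩ := h
    have e1 := hs 0 _ (hvW 1)
    have e2 := hs 0 _ (hvW 2)
    have e3 := hs 0 _ (hvW 3)
    rw [← h] at e1 e2 e3
    have g := hG 1 2 3 (by decide) (by decide) (by decide)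
    obtain ⟨g1, g2, g3, g4, g5⟩ := perm 1 2 3
    simp only [map_add, map_smul, LinearMap.add_apply, LinearMap.smul_apply, smul_eq_mul,
      hs _ _ (hvW _), hs' _ _ (hvW _), hs'' _ _ (hvW _), g1, g2, g3, g4, g5] at e1 e2 e3
    have k1 : s * t = 0 := (mul_eq_zero.1 (by linear_combination e1 / 2)).resolve_right g
    have k2 : r * t = 0 := (mul_eq_zero.1 (by linear_combination e2 / 2)).resolve_right g
    have k3 : r * s = 0 := (mul_eq_zero.1 (by linear_combination e3 / 2)).resolve_right g
    rcases mul_eq_zero.1 k1 with rfl | rfl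
    · rcases mul_eq_zero.1 k2 with rfl | rfl
      · exact hpair 0 3 (by decide) t (by rw [← h]; simp)
      · exact hpair 0 1 (by decide) r (by rw [← h]; simp)
    · rcases mul_eq_zero.1 k3 with rfl | rfl
      · exact hpair 0 2 (by decide) s (by rw [← h]; simp)
      · exact hpair 0 1 (by decide) r (by rw [← h]; simp)
  have hfin : FiniteDimensional ℂ W := Module.finite_of_finrank_pos (by omega)
  have hspan : Submodule.span ℂ (Set.range ![v 0, v 1, v 2, v 3]) = W := by
    refine Submodule.eq_of_le_of_finrank_eq (Submodule.span_le.2 ?_) ?_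
    · rintro _ ⟨a, rfl⟩
      fin_cases a <;> simp [hvW]
    · rw [finrank_span_eq_card h4, hW]; rfl
  obtain ⟨x, hx⟩ := (Submodule.mem_span_range_iff_exists_fun ℂ).1 (hspan.symm ▸ hvW 4)
  simp only [Fin.sum_univ_four, Matrix.cons_val] at hx
  have e := fun i => hs 4 _ (hvW i)
  rw [← hx] at e
  obtain ⟨p1, p2, p3, p4, p5⟩ := perm 0 1 2
  obtain ⟨q1, q2, q3, q4, q5⟩ := perm 0 1 3
  obtain ⟨r1, r2, r3, r4, r5⟩ := perm 0 2 3
  obtain ⟨s1, s2, s3, s4, s5⟩ := perm 1 2 3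
  have e0 := e 0
  have e1 := e 1
  have e2 := e 2
  have e3 := e 3
  simp only [map_add, map_smul, LinearMap.add_apply, LinearMap.smul_apply, smul_eq_mul,
    hs _ _ (hvW _), hs' _ _ (hvW _), hs'' _ _ (hvW _), p1, p2, p3, p4, p5, q1, q2, q3, q4, q5,
    r1, r2, r3, r4, r5, s1, s2, s3, s4, s5] at e0 e1 e2 e3
  -- Combining the partial derivatives at the fifth point, multiplied by its coordinates, isolates
  -- each monomial of the cubic. All triple products vanish, so at most two coordinates survive,
  -- against non-collinearity.
  have k0 : x 0 * x 1 * x 2 = 0 :=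
    (mul_eq_zero.1 (by
      linear_combination 1 / 6 * (x 0 * e0 + x 1 * e1 + x 2 * e2 - 2 * x 3 * e3))).resolve_right
      (hG 0 1 2 (by decide) (by decide) (by decide))
  have k1 : x 0 * x 1 * x 3 = 0 :=
    (mul_eq_zero.1 (by
      linear_combination 1 / 6 * (x 0 * e0 + x 1 * e1 + x 3 * e3 - 2 * x 2 * e2))).resolve_right
      (hG 0 1 3 (by decide) (by decide) (by decide))
  have k2 : x 0 * x 2 * x 3 = 0 :=
    (mul_eq_zero.1 (by
      linear_combination 1 / 6 * (x 0 * e0 + x 2 * e2 + x 3 * e3 - 2 * x 1 * e1))).resolve_right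
      (hG 0 2 3 (by decide) (by decide) (by decide))
  have k3 : x 1 * x 2 * x 3 = 0 :=
    (mul_eq_zero.1 (by
      linear_combination 1 / 6 * (x 1 * e1 + x 2 * e2 + x 3 * e3 - 2 * x 0 * e0))).resolve_right
      (hG 1 2 3 (by decide) (by decide) (by decide))
  have hno : ∀ i j, i ≠ 4 → j ≠ 4 → i ≠ j → ∀ s t : ℂ, v 4 ≠ s • v i + t • v j := by
    intro i j hi hj hij s t h
    have := (linearIndependent_finCons.1 (h3 4 i j hi.symm hj.symm hij)).2
    refine this ?_
    rw [Matrix.range_cons, Matrix.range_cons, Matrix.range_empty, Set.union_empty,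
      Set.singleton_union, Submodule.mem_span_pair]
    exact ⟨s, t, h.symm⟩
  have n01 := hno 0 1 (by decide) (by decide) (by decide) (x 0) (x 1)
  have n02 := hno 0 2 (by decide) (by decide) (by decide) (x 0) (x 2)
  have n03 := hno 0 3 (by decide) (by decide) (by decide) (x 0) (x 3)
  have n12 := hno 1 2 (by decide) (by decide) (by decide) (x 1) (x 2)
  have n13 := hno 1 3 (by decide) (by decide) (by decide) (x 1) (x 3)
  have n23 := hno 2 3 (by decide) (by decide) (by decide) (x 2) (x 3)
  rw [← hx] at n01 n02 n03 n12 n13 n23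
  simp only [mul_eq_zero] at k0 k1 k2 k3
  rcases k0 with (h | h) | h <;> rw [h] at n01 n02 n03 n12 n13 n23 <;>
    simp only [h, true_or, or_true] at k1 k2 k3
  · rcases k3 with (h' | h') | h' <;> simp [h'] at n01 n02 n03 n12 n13 n23
  · rcases k2 with (h' | h') | h' <;> simp [h'] at n01 n02 n03 n12 n13 n23
  · rcases k1 with (h' | h') | h' <;> simp [h'] at n01 n02 n03 n12 n13 n23

theorem linearIndependent_pair_of_apply_eq_one {ι : Type*} {u v : ι → ℂ} (i : ι) (hu : u i = 1)
    (hv : v i = 1) (h : u ≠ v) : LinearIndependent ℂ ![u, v] := by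
  refine LinearIndependent.pair_iff.2 fun s t hst => ?_
  have h1 := congrFun hst i
  simp only [Pi.add_apply, Pi.smul_apply, hu, hv, smul_eq_mul, mul_one, Pi.zero_apply] at h1
  obtain rfl : t = -s := by linear_combination h1
  have h2 : s • (u - v) = 0 := by rw [← hst]; module
  rcases smul_eq_zero.1 h2 with h2 | h2
  · simp [h2]
  · exact absurd (sub_eq_zero.1 h2) h

/-- A surface section with infinitely many singular points in an affine chart has a double line. -/
theorem Frame.exists_line_of_infinite (A : Frame) {f : MvPolynomial (Fin 6) ℂ}
    (hf : f.IsHomogeneous 3) (hI : IsIntegralSection f A.toGrass) (h0 : A.restrict f ≠ 0) (i : Fin 6)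
    (hinf : {z | z ∈ A.rowSpace ∧ z i = 1 ∧ ∀ w ∈ A.rowSpace, polar f ℂ z z w = 0}.Infinite) :
    ∃ u ∈ A.rowSpace, ∃ v ∈ A.rowSpace, LinearIndependent ℂ ![u, v] ∧ ∀ w ∈ A.rowSpace,
      polar f ℂ u u w = 0 ∧ polar f ℂ u v w = 0 ∧ polar f ℂ v v w = 0 := by
  obtain ⟨T, hT, hcard⟩ := hinf.exists_subset_card_eq 5
  let v : Fin 5 → Fin 6 → ℂ := fun k => (T.equivFinOfCardEq hcard).symm k
  have hv : Function.Injective v :=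
    Subtype.val_injective.comp (T.equivFinOfCardEq hcard).symm.injective
  have hvT : ∀ k, v k ∈ A.rowSpace ∧ v k i = 1 ∧ ∀ w ∈ A.rowSpace, polar f ℂ (v k) (v k) w = 0 :=
    fun k => hT ((T.equivFinOfCardEq hcard).symm k).2
  have hp : ∀ j k, j ≠ k → LinearIndependent ℂ ![v j, v k] := fun j k hjk =>
    linearIndependent_pair_of_apply_eq_one i (hvT j).2.1 (hvT k).2.1 (hv.ne hjk)
  obtain ⟨j, k, hjk, h⟩ := exists_line_of_five (polar f ℂ) (polar_swap_left f) (polar_swap_right f)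
    A.rowSpace A.finrank_rowSpace (fun u hu huW hus hG => by
      obtain ⟨x, hx⟩ := A.exists_eval_ne_zero hf hI h0 hu huW
      refine hx ?_
      have hus' : ∀ i, ∀ w ∈ A.rowSpace, polar f ℂ (u i) w (u i) = 0 := fun i w hw => by
        rw [polar_swap_right, hus i w hw]
      have hus'' : ∀ i, ∀ w ∈ A.rowSpace, polar f ℂ w (u i) (u i) = 0 := fun i w hw => by
        rw [polar_swap_left, hus' i w hw]
      have e := polar_self_eval hf (∑ i, x i • u i)
      have g1 : polar f ℂ (u 0) (u 2) (u 1) = 0 := by rw [polar_swap_right, hG]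
      have g2 : polar f ℂ (u 1) (u 0) (u 2) = 0 := by rw [polar_swap_left, hG]
      have g3 : polar f ℂ (u 1) (u 2) (u 0) = 0 := by rw [polar_swap_right, g2]
      have g4 : polar f ℂ (u 2) (u 0) (u 1) = 0 := by rw [polar_swap_left, g1]
      have g5 : polar f ℂ (u 2) (u 1) (u 0) = 0 := by rw [polar_swap_right, g4]
      simp only [Fin.sum_univ_three, map_add, map_smul, LinearMap.add_apply, LinearMap.smul_apply,
        smul_eq_mul, hus _ _ (huW _), hus' _ _ (huW _), hus'' _ _ (huW _), hG, g1, g2, g3, g4, g5,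
        mul_zero, add_zero] at e
      rw [Fin.sum_univ_three]
      simpa using e.symm) v
    (fun k => (hvT k).1) (fun k => (hvT k).2.2) hp
  exact ⟨v j, (hvT j).1, v k, (hvT k).1, hp j k hjk, fun w hw =>
    ⟨(hvT j).2.2 w hw, h w hw, (hvT k).2.2 w hw⟩⟩

/-! ### Affine charts of the section and their projections to a plane -/

theorem aeval_smul_of_isHomogeneous {σ S : Type*} [CommRing S] [Algebra ℂ S] {p : MvPolynomial σ ℂ}
    {n : ℕ} (hp : p.IsHomogeneous n) (c : S) (x : σ → S) :
    aeval (c • x) p = c ^ n * aeval x p := by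
  rw [aeval_def, aeval_def, eval₂_eq, eval₂_eq, Finset.mul_sum]
  refine Finset.sum_congr rfl fun d hd => ?_
  have h : ∑ i ∈ d.support, d i = n := by
    have := hp (mem_support_iff.1 hd)
    rwa [Finsupp.weight_apply, Finsupp.sum, Finset.sum_congr rfl (g := d) (by simp)] at this
  simp only [Pi.smul_apply, smul_eq_mul, mul_pow, Finset.prod_mul_distrib, Finset.prod_pow_eq_pow_sum,
    h]
  ring

theorem isHomogeneous_linearForm (a : Fin 6 → ℂ) : (linearForm a).IsHomogeneous 1 :=
  IsHomogeneous.sum _ _ _ fun _ _ => isHomogeneous_C_mul_X _ _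

/-- Dehomogenization `X j ↦ X j / X i` embeds the chart ring into the localization at `X i` of the
homogeneous coordinate ring, a domain. The map `ρ` back to the chart ring shows that the kernel is
no larger than expected. -/
theorem isDomain_chartRing {f : MvPolynomial (Fin 6) ℂ} (hf : f.IsHomogeneous 3) {N : Grass}
    (hI : IsIntegralSection f N) {i : Fin 6} (hi : X i ∉ sectionIdeal f N) :
    IsDomain (ChartRing f N i) := by
  set I := sectionIdeal f N with hIdef
  have hIp : I.IsPrime := hI
  let x : MvPolynomial (Fin 6) ℂ ⧸ I := Ideal.Quotient.mk I (X i)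
  have hx : x ≠ 0 := fun h => hi (Ideal.Quotient.eq_zero_iff_mem.1 h)
  let T := Localization.Away x
  have hT : IsDomain T :=
    IsLocalization.isDomain_localization (powers_le_nonZeroDivisors_of_noZeroDivisors hx)
  let y : T := IsLocalization.Away.invSelf x
  have hxy : algebraMap _ T x * y = 1 := IsLocalization.Away.mul_invSelf x
  let mk : MvPolynomial (Fin 6) ℂ →ₐ[ℂ] T :=
    (IsScalarTower.toAlgHom ℂ (MvPolynomial (Fin 6) ℂ ⧸ I) T).comp (Ideal.Quotient.mkₐ ℂ I)
  let ψ : MvPolynomial (Fin 6) ℂ →ₐ[ℂ] T := aeval (y • fun j => mk (X j))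
  have hmk : ∀ p, aeval (fun j => mk (X j)) p = mk p := fun p => by
    rw [show (fun j => mk (X j)) = mk ∘ X from rfl, ← MvPolynomial.aeval_unique]
  have hgen : ∀ {p : MvPolynomial (Fin 6) ℂ} {n : ℕ}, p.IsHomogeneous n → p ∈ I → ψ p = 0 := by
    intro p n hp hpI
    have h0 : mk p = 0 := by
      change algebraMap _ T (Ideal.Quotient.mk I p) = 0
      rw [Ideal.Quotient.eq_zero_iff_mem.2 hpI, map_zero]
    change aeval _ p = 0
    rw [aeval_smul_of_isHomogeneous hp, hmk, h0, mul_zero]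
  have hle : I ⊔ Ideal.span {X i - 1} ≤ RingHom.ker ψ := by
    refine sup_le (Ideal.span_le.2 ?_) (Ideal.span_le.2 ?_)
    · rintro p hp
      refine RingHom.mem_ker.2 ?_
      have hpI : p ∈ I := Ideal.subset_span hp
      rcases hp with rfl | ⟨a, ha, rfl⟩
      · exact hgen hf hpI
      · exact hgen (isHomogeneous_linearForm a) hpI
    · rintro _ rfl
      refine RingHom.mem_ker.2 ?_
      rw [map_sub, map_one, sub_eq_zero]
      change aeval _ (X i) = 1
      rw [aeval_X, Pi.smul_apply, smul_eq_mul, mul_comm]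
      exact hxy
  let q : MvPolynomial (Fin 6) ℂ ⧸ I →ₐ[ℂ] ChartRing f N i :=
    Ideal.Quotient.factorₐ ℂ (le_sup_left : I ≤ I ⊔ Ideal.span {X i - 1})
  have hq : ∀ p, q (Ideal.Quotient.mk I p) = Ideal.Quotient.mk _ p := fun p => rfl
  have hqx : q x = 1 := by
    rw [hq, ← map_one (Ideal.Quotient.mk _), Ideal.Quotient.eq]
    exact Ideal.mem_sup_right (Ideal.subset_span rfl)
  let ρ : T →+* ChartRing f N i := IsLocalization.Away.lift (g := q.toRingHom) x (by
    change IsUnit (q x)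
    rw [hqx]; exact isUnit_one)
  have hρ : ∀ z, ρ (algebraMap _ T z) = q z := fun z => IsLocalization.Away.lift_eq _ _ z
  have hρy : ρ y = 1 := by
    have := congrArg ρ hxy
    rwa [map_mul, hρ, hqx, one_mul, map_one] at this
  have hρψ : ρ.comp ψ.toRingHom = Ideal.Quotient.mk _ := by
    refine MvPolynomial.ringHom_ext (fun c => ?_) fun j => ?_
    · change ρ (ψ (C c)) = _
      have : ψ (C c) = algebraMap _ T (Ideal.Quotient.mk I (C c)) := (aeval_C _ c)
      rw [this, hρ, hq]
    · change ρ (aeval _ (X j)) = _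
      rw [aeval_X, Pi.smul_apply, smul_eq_mul, map_mul, hρy, one_mul]
      exact hρ _
  have hker : RingHom.ker ψ = I ⊔ Ideal.span {X i - 1} := by
    refine le_antisymm (fun p hp => ?_) hle
    rw [← Ideal.Quotient.eq_zero_iff_mem, ← hρψ]
    change ρ (ψ p) = 0
    rw [(RingHom.mem_ker).1 hp, map_zero]
  have : (I ⊔ Ideal.span {X i - 1}).IsPrime := hker ▸ RingHom.ker_isPrime ψ
  exact Ideal.Quotient.isDomain _

theorem exists_chart_not_isIntegrallyClosed {f : MvPolynomial (Fin 6) ℂ} (hf : f.IsHomogeneous 3)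
    {N : Grass} (hI : IsIntegralSection f N) (hN : ¬ IsNormalSection f N) :
    ∃ i, X i ∉ sectionIdeal f N ∧ ¬ IsIntegrallyClosed (ChartRing f N i) := by
  simp only [IsNormalSection, not_forall] at hN
  obtain ⟨i, p, hp, h⟩ := hN
  have hi : X i ∉ sectionIdeal f N := fun hi => by
    have : sectionIdeal f N ⊔ Ideal.span {X i - 1} = ⊤ := by
      rw [Ideal.eq_top_iff_one]
      simpa only [sub_sub_cancel] using sub_mem (Ideal.mem_sup_left hi)
        (Ideal.mem_sup_right (Ideal.subset_span rfl) :
          X i - 1 ∈ sectionIdeal f N ⊔ Ideal.span {X i - 1})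
    have := Ideal.Quotient.subsingleton_iff.2 this
    exact hp.ne_top (Subsingleton.elim _ _)
  have := isDomain_chartRing hf hI hi
  refine ⟨i, hi, fun hic => h ⟨?_, ?_⟩⟩
  · exact IsLocalization.isDomain_localization p.primeCompl_le_nonZeroDivisors
  · exact isIntegrallyClosed_of_isLocalization _ p.primeCompl p.primeCompl_le_nonZeroDivisors

theorem Frame.exists_coordinates (B : Frame) (f : MvPolynomial (Fin 6) ℂ) {i : Fin 6}
    (hB : ∀ r, B.1 r i = if r = 0 then 1 else 0) : ∃ ξ : Fin 4 → ChartRing f B.toGrass i,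
      (∀ p, Ideal.Quotient.mk _ p = aeval ξ (B.restrict p)) ∧ ξ 0 = 1 := by
  set J := sectionIdeal f B.toGrass ⊔ Ideal.span {X i - 1}
  choose q hq using fun r => B.restrict_surjective (X r)
  have key : ∀ p, Ideal.Quotient.mk J p = aeval (fun r => Ideal.Quotient.mk J (q r)) (B.restrict p) := by
    intro p
    have h1 : B.restrict (aeval q (B.restrict p)) = B.restrict p := by
      rw [← AlgHom.comp_apply, comp_aeval]
      simp only [hq]
      exact DFunLike.congr_fun aeval_X_left _
    have h2 : p - aeval q (B.restrict p) ∈ J := by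
      refine Ideal.mem_sup_left (Ideal.span_mono (Set.subset_insert _ _) (B.ker_restrict_le ?_))
      rw [RingHom.mem_ker, map_sub, h1, sub_self]
    rw [Ideal.Quotient.eq.2 h2]
    exact DFunLike.congr_fun (comp_aeval q (Ideal.Quotient.mkₐ ℂ J)) _
  refine ⟨_, key, ?_⟩
  have h := key (X i)
  have hX : B.restrict (X i) = X 0 := by
    simp [Frame.restrict, hB]
  rw [hX, aeval_X] at h
  rw [← h, ← map_one (Ideal.Quotient.mk J), Ideal.Quotient.eq]
  exact Ideal.mem_sup_right (Ideal.subset_span rfl)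

theorem eval₂_cubic {A R : Type*} [CommRing A] [CommRing R] (φ : A →+* R) (θ : R) (a b c d : A) :
    (Polynomial.C a * Polynomial.X ^ 3 + Polynomial.C b * Polynomial.X ^ 2 +
      Polynomial.C c * Polynomial.X + Polynomial.C d).eval₂ φ θ =
      φ a * θ ^ 3 + φ b * θ ^ 2 + φ c * θ + φ d := by
  simp [Polynomial.eval₂_add, Polynomial.eval₂_mul]

theorem eval₂_derivative_cubic {A R : Type*} [CommRing A] [CommRing R] (φ : A →+* R) (θ : R)
    (a b c d : A) :
    (Polynomial.C a * Polynomial.X ^ 3 + Polynomial.C b * Polynomial.X ^ 2 +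
      Polynomial.C c * Polynomial.X + Polynomial.C d).derivative.eval₂ φ θ =
      3 * φ a * θ ^ 2 + 2 * φ b * θ + φ c := by
  simp [Polynomial.eval₂_add, Polynomial.eval₂_mul]
  have h : φ 2 = 2 := map_ofNat φ 2
  linear_combination φ a * θ ^ 2 * h

theorem mk_polar (f : MvPolynomial (Fin 6) ℂ) (J : Ideal (MvPolynomial (Fin 6) ℂ))
    (u : Fin 6 → ℂ) : Ideal.Quotient.mk J (polar f _ (C ∘ u) X X) =
      polar f _ (algebraMap ℂ _ ∘ u) (fun j => Ideal.Quotient.mk J (X j))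
        (fun j => Ideal.Quotient.mk J (X j)) :=
  map_polar f (Ideal.Quotient.mkₐ ℂ J) _ _ _

theorem polar_square_add_smul (f : MvPolynomial (Fin 6) ℂ) {R : Type*} [CommRing R] [Algebra ℂ R]
    (z p : Fin 6 → R) (s : R) :
    polar f R p (z + s • p) (z + s • p) = polar f R p z z + 2 * s * polar f R p p z +
      s ^ 2 * polar f R p p p := by
  simp only [map_add, map_smul, LinearMap.add_apply, LinearMap.smul_apply, smul_eq_mul]
  rw [polar_swap_right f p z p]
  ring

theorem exists_eval_add_smul_eq_zero {f : MvPolynomial (Fin 6) ℂ} (hf : f.IsHomogeneous 3)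
    (z : Fin 6 → ℂ) {v : Fin 6 → ℂ} (hv : eval v f ≠ 0) : ∃ t : ℂ, eval (z + t • v) f = 0 := by
  let P : Polynomial ℂ := Polynomial.C (polar f ℂ v v v) * Polynomial.X ^ 3 +
    Polynomial.C (3 * polar f ℂ v v z) * Polynomial.X ^ 2 +
    Polynomial.C (3 * polar f ℂ v z z) * Polynomial.X + Polynomial.C (polar f ℂ z z z)
  have hP : P.degree = 3 := Polynomial.degree_cubic (by rw [polar_self_eval hf]; simpa using hv)
  obtain ⟨t, ht⟩ := IsAlgClosed.exists_root P (by rw [hP]; decide)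
  refine ⟨t, ?_⟩
  have h := polar_cube_add_smul f z v t
  rw [polar_self_eval hf] at h
  have h6 : (6 : ℂ) * eval (z + t • v) f = 0 := by
    rw [h, ← ht]
    simp [P]
    ring
  simpa using h6

theorem eval_linearForm (a z : Fin 6 → ℂ) : eval z (linearForm a) = a ⬝ᵥ z := by
  simp [linearForm, dotProduct]

theorem Frame.eval_eq_zero_of_mem (B : Frame) {f : MvPolynomial (Fin 6) ℂ} {i : Fin 6}
    {z : Fin 6 → ℂ} (hz : z ∈ B.rowSpace) (hzi : z i = 1) (hzf : eval z f = 0)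
    {p : MvPolynomial (Fin 6) ℂ} (hp : p ∈ sectionIdeal f B.toGrass ⊔ Ideal.span {X i - 1}) :
    eval z p = 0 := by
  have : sectionIdeal f B.toGrass ⊔ Ideal.span {X i - 1} ≤ RingHom.ker (eval z) := by
    refine sup_le (Ideal.span_le.2 ?_) (Ideal.span_le.2 ?_)
    · rintro _ (rfl | ⟨a, ha, rfl⟩)
      · exact hzf
      · exact (eval_linearForm a z).trans (Frame.mem_rowSpace_iff.1 hz a ha)
    · rintro _ rfl
      simp [RingHom.mem_ker, hzi]
  exact this hp

/-- Projection from a point off the section presents the chart as a hypersurface over the plane. -/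
theorem Frame.exists_projection (B : Frame) {f : MvPolynomial (Fin 6) ℂ} (hf : f.IsHomogeneous 3)
    {i : Fin 6} (hB : ∀ r, B.1 r i = if r = 0 then 1 else 0) (hv : eval (B.1 3) f ≠ 0) :
    ∃ (φ : MvPolynomial (Fin 2) ℂ →ₐ[ℂ] ChartRing f B.toGrass i) (θ : ChartRing f B.toGrass i)
      (Q : Polynomial (MvPolynomial (Fin 2) ℂ)), Function.Injective φ ∧
      (∀ p, Ideal.Quotient.mk _ p = aeval ![1, φ (X 0), φ (X 1), θ] (B.restrict p)) ∧
      φ.toRingHom.IsIntegralElem θ ∧ Q.eval₂ φ.toRingHom θ = 0 ∧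
      Q.derivative.eval₂ φ.toRingHom θ =
        Ideal.Quotient.mk _ (3 * polar f _ (C ∘ B.1 3) X X) := by
  obtain ⟨ξ, hξ, hξ0⟩ := B.exists_coordinates f hB
  let φ : MvPolynomial (Fin 2) ℂ →ₐ[ℂ] ChartRing f B.toGrass i := aeval ![ξ 1, ξ 2]
  have hφ0 : φ (X 0) = ξ 1 := by simp [φ]
  have hφ1 : φ (X 1) = ξ 2 := by simp [φ]
  have hξ' : ![1, φ (X 0), φ (X 1), ξ 3] = ξ := by
    ext r
    fin_cases r <;> simp [hξ0, hφ0, hφ1]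
  let v : Fin 6 → MvPolynomial (Fin 2) ℂ := C ∘ B.1 3
  let z : Fin 6 → MvPolynomial (Fin 2) ℂ := fun j => C (B.1 0 j) + X 0 * C (B.1 1 j) + X 1 * C (B.1 2 j)
  let ζ : Fin 6 → ChartRing f B.toGrass i := fun j => Ideal.Quotient.mk _ (X j)
  have hφv : φ ∘ v = algebraMap ℂ _ ∘ B.1 3 := by
    ext j
    simp [v, φ]
  have hζ : ζ = φ ∘ z + ξ 3 • (φ ∘ v) := by
    ext j
    have h := hξ (X j)
    rw [Frame.restrict, aeval_X, Fin.sum_univ_four] at h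
    simp only [map_add, map_mul, algHom_C, aeval_X, hξ0] at h
    rw [hφv]
    simp only [ζ, Pi.add_apply, Function.comp_apply, Pi.smul_apply, smul_eq_mul, z, map_add, map_mul,
      hφ0, hφ1, algHom_C, h]
    ring
  -- The expansion of the polar cube at `z + T v`. Its leading coefficient is the nonzero constant
  -- `6 f(v)`, so `Q` is monic up to a unit.
  let Q : Polynomial (MvPolynomial (Fin 2) ℂ) :=
    Polynomial.C (polar f _ v v v) * Polynomial.X ^ 3 +
    Polynomial.C (3 * polar f _ v v z) * Polynomial.X ^ 2 +
    Polynomial.C (3 * polar f _ v z z) * Polynomial.X + Polynomial.C (polar f _ z z z)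
  have hpol : ∀ a b c, φ (polar f _ a b c) = polar f _ (φ ∘ a) (φ ∘ b) (φ ∘ c) := map_polar f φ
  have hQ : Q.eval₂ φ.toRingHom (ξ 3) = 0 := by
    have h1 : polar f _ ζ ζ ζ = 0 := by
      rw [polar_self hf]
      have : aeval ζ f = Ideal.Quotient.mk _ f :=
        (DFunLike.congr_fun (aeval_unique (Ideal.Quotient.mkₐ ℂ _)) f).symm
      rw [this, Ideal.Quotient.eq_zero_iff_mem.2, mul_zero]
      exact Ideal.mem_sup_left (Ideal.subset_span (Set.mem_insert _ _))
    rw [hζ, polar_cube_add_smul] at h1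
    rw [← h1, eval₂_cubic]
    simp only [AlgHom.toRingHom_eq_coe, RingHom.coe_coe, map_mul, hpol, map_ofNat]
    ring
  have hvv : polar f _ v v v = C (6 * eval (B.1 3) f) := by
    rw [← polar_self_eval hf]
    exact (map_polar f (Algebra.ofId ℂ (MvPolynomial (Fin 2) ℂ)) _ _ _).symm
  have h6 : 6 * eval (B.1 3) f ≠ 0 := by simpa using hv
  have hvv0 : polar f _ v v v ≠ 0 := by rw [hvv]; simpa using hv
  refine ⟨φ, ξ 3, Q, ?_, hξ'.symm ▸ hξ, ?_, hQ, ?_⟩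
  · rw [injective_iff_map_eq_zero]
    intro c hc
    refine MvPolynomial.funext fun y => ?_
    -- Every point of the plane lifts to the surface, so a polynomial that becomes zero in the chart
    -- ring vanishes everywhere on the plane.
    obtain ⟨t, ht⟩ := exists_eval_add_smul_eq_zero hf
      (B.1 0 + y 0 • B.1 1 + y 1 • B.1 2) hv
    set x : Fin 4 → ℂ := ![1, y 0, y 1, t] with hx
    have hsum : ∑ r, x r • B.1 r = B.1 0 + y 0 • B.1 1 + y 1 • B.1 2 + t • B.1 3 := by
      simp [hx, Fin.sum_univ_four]
    obtain ⟨p, hp⟩ := B.restrict_surjective (rename ![1, 2] c)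
    have hmem : p ∈ sectionIdeal f B.toGrass ⊔ Ideal.span {X i - 1} := by
      rw [← Ideal.Quotient.eq_zero_iff_mem, hξ, hp, aeval_rename, ← hc]
      change _ = aeval ![ξ 1, ξ 2] c
      congr 2
      ext k
      fin_cases k <;> rfl
    have h := B.eval_eq_zero_of_mem (Frame.mem_rowSpace.2 ⟨x, hsum⟩) (by simp [hB]) ht hmem
    rw [← hsum, ← B.eval_restrict, hp, eval_rename] at h
    rw [map_zero, ← h]
    congr 2
    ext k
    fin_cases k <;> simp [hx]
  · refine ⟨Polynomial.C (C (6 * eval (B.1 3) f)⁻¹) * Q,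
      Polynomial.monic_C_mul_of_mul_leadingCoeff_eq_one ?_, ?_⟩
    · rw [Polynomial.leadingCoeff_cubic hvv0, hvv, ← C_mul, inv_mul_cancel₀ h6, C_1]
    · rw [Polynomial.eval₂_mul, hQ, mul_zero]
  · have h2 := mk_polar f (sectionIdeal f B.toGrass ⊔ Ideal.span {X i - 1}) (B.1 3)
    rw [← hφv, show (fun j => Ideal.Quotient.mk _ (X j)) = ζ from rfl] at h2
    rw [map_mul, map_ofNat, h2, hζ, polar_square_add_smul, eval₂_derivative_cubic]
    simp only [AlgHom.toRingHom_eq_coe, RingHom.coe_coe, map_mul, hpol, map_ofNat]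
    ring

theorem Frame.exists_notMem_span (A : Frame) {n : ℕ} (hn : n < 4) (v : Fin n → Fin 6 → ℂ)
    {z : Fin 6 → ℂ} (hz : z ∈ A.rowSpace) {i : Fin 6} (hzi : z i = 1)
    (hzv : z ∈ Submodule.span ℂ (Set.range v)) :
    ∃ u ∈ A.rowSpace, u i = 0 ∧ u ∉ Submodule.span ℂ (Set.range v) := by
  obtain ⟨u, huW, hu⟩ : ∃ u ∈ A.rowSpace, u ∉ Submodule.span ℂ (Set.range v) := by
    by_contra! h
    have := Submodule.finrank_mono (show A.rowSpace ≤ Submodule.span ℂ (Set.range v) from h)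
    rw [A.finrank_rowSpace] at this
    have := finrank_range_le_card (R := ℂ) v
    rw [Set.finrank, Fintype.card_fin] at this
    omega
  refine ⟨u - u i • z, sub_mem huW (Submodule.smul_mem _ _ hz), by simp [hzi], fun h => hu ?_⟩
  simpa using add_mem h (Submodule.smul_mem _ (u i) hzv)

theorem Frame.exists_frame_of_mem (A : Frame) {z v : Fin 6 → ℂ} (hz : z ∈ A.rowSpace)
    (hvW : v ∈ A.rowSpace) {i : Fin 6} (hzi : z i = 1) (hvi : v i = 0) (hv : v ≠ 0) :
    ∃ B : Frame, B.toGrass = A.toGrass ∧ B.1 0 = z ∧ B.1 3 = v ∧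
      ∀ r, B.1 r i = if r = 0 then 1 else 0 := by
  have h2 : LinearIndependent ℂ ![z, v] := by
    refine LinearIndependent.pair_iff.2 fun s t h => ?_
    have h1 := congrFun h i
    simp only [Pi.add_apply, Pi.smul_apply, hzi, hvi, smul_eq_mul, mul_one, mul_zero, add_zero,
      Pi.zero_apply] at h1
    subst h1
    simpa [hv] using h
  obtain ⟨u, huW, hui, hu⟩ := A.exists_notMem_span (by norm_num) ![z, v] hz hzi
    (Submodule.subset_span ⟨0, rfl⟩)
  have h3 : LinearIndependent ℂ ![u, z, v] := linearIndependent_finCons.2 ⟨h2, hu⟩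
  obtain ⟨w, hwW, hwi, hw⟩ := A.exists_notMem_span (by norm_num) ![u, z, v] hz hzi
    (Submodule.subset_span ⟨1, rfl⟩)
  have h4 : LinearIndependent ℂ ![w, u, z, v] := linearIndependent_finCons.2 ⟨h3, hw⟩
  obtain ⟨B, hB, hBA⟩ := A.exists_of_linearIndependent (h4.comp ![2, 1, 0, 3] (by decide))
    (fun r => by fin_cases r <;> simp [hz, hvW, huW, hwW])
  refine ⟨B, hBA, by rw [hB]; rfl, by rw [hB]; rfl, fun r => ?_⟩
  rw [hB]
  fin_cases r <;> simp [hzi, hvi, hui, hwi]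

/-- This supplies a center of projection at infinity: the cubic does not vanish identically on the
plane where the `i`-th coordinate is zero. -/
theorem Frame.exists_eval_ne_zero_of_apply_eq_zero (A : Frame) {f : MvPolynomial (Fin 6) ℂ}
    (hf : f.IsHomogeneous 3) (hI : IsIntegralSection f A.toGrass) (h0 : A.restrict f ≠ 0)
    {z : Fin 6 → ℂ} (hz : z ∈ A.rowSpace) {i : Fin 6} (hzi : z i = 1) :
    ∃ u ∈ A.rowSpace, u i = 0 ∧ eval u f ≠ 0 := by
  obtain ⟨v, hvW, hvi, hv⟩ := A.exists_notMem_span (by norm_num) ![z] hz hzi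
    (Submodule.subset_span ⟨0, rfl⟩)
  obtain ⟨B, hBA, -, -, hB⟩ := A.exists_frame_of_mem hz hvW hzi hvi
    (fun h => hv (h ▸ zero_mem _))
  have hBW : ∀ r, B.1 r ∈ A.rowSpace := fun r =>
    Frame.rowSpace_congr hBA ▸ Submodule.subset_span ⟨r, rfl⟩
  obtain ⟨x, hx⟩ := A.exists_eval_ne_zero hf hI h0
    (B.linearIndependent.comp Fin.succ (Fin.succ_injective 3)) fun r => hBW _
  refine ⟨_, Submodule.sum_mem _ fun r _ => Submodule.smul_mem _ _ (hBW _), ?_, hx⟩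
  simp [Finset.sum_apply, hB]

theorem isRelPrime_X_sub_C {σ : Type*} {i j : σ} (hij : i ≠ j) (a b : ℂ) :
    IsRelPrime (X i - C a : MvPolynomial σ ℂ) (X j - C b) := by
  classical
  have hcoeff : coeff (Finsupp.single i 1) (X i - C a : MvPolynomial σ ℂ) = 1 := by
    have h0 : (0 : σ →₀ ℕ) ≠ Finsupp.single i 1 := (Finsupp.single_ne_zero.2 one_ne_zero).symm
    rw [coeff_sub, coeff_X, if_pos rfl, coeff_C, if_neg h0, sub_zero]
  have hirr : Irreducible (X i - C a : MvPolynomial σ ℂ) := by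
    refine irreducible_of_totalDegree_eq_one (le_antisymm ?_ ?_) fun x hx =>
      isUnit_of_dvd_one (hcoeff ▸ hx _)
    · refine (totalDegree_sub _ _).trans ?_
      simp
    · have := le_totalDegree (p := (X i - C a : MvPolynomial σ ℂ)) (s := Finsupp.single i 1)
        (by rw [mem_support_iff, hcoeff]; exact one_ne_zero)
      simpa using this
  refine (hirr.isRelPrime_iff_not_dvd).2 fun ⟨q, hq⟩ => ?_
  have := congrArg (eval (Function.update (fun _ => a) j (b + 1))) hq
  simp [hij] at this

/-- The numerators `c` for which `c b` lies in the coordinate ring `R`. -/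
def numeratorIdeal {S R L : Type*} [CommRing S] [CommRing R] [Field L] [Algebra R L]
    (π : S →+* R) (b : L) : Ideal S where
  carrier := {c | ∃ r, algebraMap R L r = algebraMap R L (π c) * b}
  zero_mem' := ⟨0, by simp⟩
  add_mem' := by
    rintro c d ⟨r, hr⟩ ⟨s, hs⟩
    exact ⟨r + s, by rw [map_add, map_add, map_add, hr, hs, add_mul]⟩
  smul_mem' := by
    rintro c d ⟨r, hr⟩
    exact ⟨π c * r, by rw [smul_eq_mul, map_mul, map_mul, map_mul, hr, mul_assoc]⟩

theorem mem_numeratorIdeal {S R L : Type*} [CommRing S] [CommRing R] [Field L] [Algebra R L]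
    {π : S →+* R} {b : L} {c : S} :
    c ∈ numeratorIdeal π b ↔ ∃ r, algebraMap R L r = algebraMap R L (π c) * b := Iff.rfl

/-- The two halves of the normality criterion for the projection from the last row. The polynomials
`q` lift the two coordinates of the plane. -/
theorem Frame.exists_numerators (B : Frame) {f : MvPolynomial (Fin 6) ℂ} {N : Grass}
    (hN : B.toGrass = N) {i : Fin 6}     (hf : f.IsHomogeneous 3) [IsDomain (ChartRing f N i)]
    (hB : ∀ r, B.1 r i = if r = 0 then 1 else 0) (hv : eval (B.1 3) f ≠ 0)
    {b : FractionRing (ChartRing f N i)} (hb : IsIntegral (ChartRing f N i) b) :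
    3 * polar f (MvPolynomial (Fin 6) ℂ) (C ∘ B.1 3) X X ∈
      numeratorIdeal (Ideal.Quotient.mk (sectionIdeal f N ⊔ Ideal.span {X i - 1})) b ∧
    ∃ q : Fin 2 → MvPolynomial (Fin 6) ℂ, ∀ c₁ c₂ : MvPolynomial (Fin 2) ℂ, IsRelPrime c₁ c₂ →
      c₁ ≠ 0 →
      aeval q c₁ ∈
        numeratorIdeal (Ideal.Quotient.mk (sectionIdeal f N ⊔ Ideal.span {X i - 1})) b →
      aeval q c₂ ∈
        numeratorIdeal (Ideal.Quotient.mk (sectionIdeal f N ⊔ Ideal.span {X i - 1})) b →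
      ∃ r, algebraMap (ChartRing f N i) _ r = b := by
  subst hN
  obtain ⟨φ, θ, Q, hφ, hgen, hθ, hQ, hQ'⟩ := B.exists_projection hf hB hv
  let _ : Algebra (MvPolynomial (Fin 2) ℂ) (ChartRing f B.toGrass i) := φ.toRingHom.toAlgebra
  have : FaithfulSMul (MvPolynomial (Fin 2) ℂ) (ChartRing f B.toGrass i) :=
    (faithfulSMul_iff_algebraMap_injective _ _).2 hφ
  have hθ' : IsIntegral (MvPolynomial (Fin 2) ℂ) θ := hθ
  have htop : Algebra.adjoin (MvPolynomial (Fin 2) ℂ) {θ} = ⊤ := by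
    rw [eq_top_iff]
    rintro r -
    obtain ⟨p, rfl⟩ := Ideal.Quotient.mk_surjective r
    rw [hgen]
    have hφmem : ∀ c, φ c ∈ Algebra.adjoin (MvPolynomial (Fin 2) ℂ) {θ} := fun c =>
      Subalgebra.algebraMap_mem _ c
    induction B.restrict p using MvPolynomial.induction_on with
    | C c =>
      rw [algHom_C, ← φ.commutes]
      exact hφmem _
    | add p q hp hq => rw [map_add]; exact add_mem hp hq
    | mul_X p k hp =>
      rw [map_mul, aeval_X]
      refine mul_mem hp ?_
      fin_cases k
      · exact one_mem _
      · exact hφmem _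
      · exact hφmem _
      · exact Algebra.self_mem_adjoin_singleton _ θ
  refine ⟨?_, ?_⟩
  · obtain ⟨r, hr⟩ := exists_algebraMap_eq_derivative_mul hθ' htop hb Q hQ
    exact mem_numeratorIdeal.2 ⟨r, by rw [← hQ']; exact hr⟩
  · choose q hq using fun k : Fin 2 => B.restrict_surjective (X (![1, 2] k))
    have hq' : ∀ c, Ideal.Quotient.mk (sectionIdeal f B.toGrass ⊔ Ideal.span {X i - 1})
        (aeval q c) = φ c := fun c => by
      have h1 := DFunLike.congr_fun (comp_aeval q (Ideal.Quotient.mkₐ ℂ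
        (sectionIdeal f B.toGrass ⊔ Ideal.span {X i - 1}))) c
      refine h1.trans (DFunLike.congr_fun (?_ : _ = φ) c)
      ext k
      rw [aeval_X]
      refine (hgen (q k)).trans ?_
      rw [hq, aeval_X]
      fin_cases k <;> rfl
    refine ⟨q, fun c₁ c₂ hc h0 h₁ h₂ => ?_⟩
    obtain ⟨r₁, h₁⟩ := mem_numeratorIdeal.1 h₁
    obtain ⟨r₂, h₂⟩ := mem_numeratorIdeal.1 h₂
    rw [hq'] at h₁ h₂
    exact exists_algebraMap_eq_of_isRelPrime hθ' htop hc h0 h₁ h₂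

theorem isRelPrime_prod_X_sub_C_pow {σ ι : Type*} {i j : σ} (hij : i ≠ j) (s : Finset ι)
    (a b : ι → ℂ) (m n : ℕ) :
    IsRelPrime ((∏ k ∈ s, (X i - C (a k) : MvPolynomial σ ℂ)) ^ m)
      ((∏ k ∈ s, (X j - C (b k))) ^ n) :=
  IsRelPrime.pow (IsRelPrime.prod_left fun _ _ => IsRelPrime.prod_right fun _ _ =>
    isRelPrime_X_sub_C hij _ _)

/-! ### Non-normality produces a double line -/

/-- On the line `v + s u` the cubic has nonzero leading coefficient in `s`, so it is nonzero
somewhere; there the linear form `polar f ℂ z z` vanishes, as it does at `u`, hence also at `v`. -/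
theorem polar_eval_self_of_forall {f : MvPolynomial (Fin 6) ℂ} {W : Submodule ℂ (Fin 6 → ℂ)}
    {z u : Fin 6 → ℂ} (hu : u ∈ W) (huf : polar f ℂ u u u ≠ 0)
    (h : ∀ v ∈ W, polar f ℂ v v v ≠ 0 → polar f ℂ z z v = 0) :
    ∀ v ∈ W, polar f ℂ z z v = 0 := by
  intro v hv
  by_contra hne
  have hu0 := h u hu huf
  have hall : ∀ s : ℂ, polar f ℂ (v + s • u) (v + s • u) (v + s • u) = 0 := fun s => by
    by_contra hs
    have := h _ (add_mem hv (W.smul_mem s hu)) hs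
    rw [map_add, map_smul, hu0, smul_zero, add_zero] at this
    exact hne this
  have h0 := hall 0
  have h1 := hall 1
  have h2 := hall (-1)
  have h3 := hall 2
  rw [polar_cube_add_smul] at h0 h1 h2 h3
  -- A third finite difference extracts the leading coefficient.
  exact huf (by linear_combination h3 / 6 - h1 / 2 - h2 / 6 + h0 / 2)

/-- For `b` integral over the chart ring, the numerators of `b` contain the derivatives of the cubic
along all admissible centers, so their common zeros are singular points. Were these finite in
number, the Nullstellensatz would give numerators that are coprime polynomials in the two plane
coordinates, and depth two would put `b` in the chart ring. -/
theorem Frame.infinite_singular_of_not_isIntegrallyClosed (A : Frame)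
    {f : MvPolynomial (Fin 6) ℂ} (hf : f.IsHomogeneous 3) (hI : IsIntegralSection f A.toGrass)
    (h0 : A.restrict f ≠ 0) {i : Fin 6} (hi : X i ∉ sectionIdeal f A.toGrass)
    (hR : ¬ IsIntegrallyClosed (ChartRing f A.toGrass i)) :
    {z | z ∈ A.rowSpace ∧ z i = 1 ∧ ∀ w ∈ A.rowSpace, polar f ℂ z z w = 0}.Infinite := by
  intro hfin
  have := isDomain_chartRing hf hI hi
  refine hR ((isIntegrallyClosed_iff (FractionRing (ChartRing f A.toGrass i))).2 fun {b} hb => ?_)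
  obtain ⟨z₀, hz₀, hz₀i⟩ : ∃ z ∈ A.rowSpace, z i = 1 := by
    have : A.restrict (X i) ≠ 0 := fun h => hi (Ideal.span_mono (Set.subset_insert _ _)
      (A.ker_restrict_le h))
    rw [Ne, A.restrict_eq_zero_iff] at this
    push Not at this
    obtain ⟨z, hz, hzi⟩ := this
    rw [eval_X] at hzi
    exact ⟨(z i)⁻¹ • z, A.rowSpace.smul_mem _ hz, by simp [hzi]⟩
  obtain ⟨u, huW, hui, huf⟩ := A.exists_eval_ne_zero_of_apply_eq_zero hf hI h0 hz₀ hz₀i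
  have hne : ∀ {v : Fin 6 → ℂ}, eval v f ≠ 0 → v ≠ 0 := by
    rintro _ hv rfl
    refine hv ?_
    have := polar_self_eval hf 0
    simpa using this.symm
  set J := sectionIdeal f A.toGrass ⊔ Ideal.span {X i - 1}
  let I := numeratorIdeal (Ideal.Quotient.mk J) b
  have hJI : J ≤ I := fun c hc => mem_numeratorIdeal.2 ⟨0, by
    rw [Ideal.Quotient.eq_zero_iff_mem.2 hc, map_zero, zero_mul]⟩
  have hframe : ∀ {z v : Fin 6 → ℂ}, z ∈ A.rowSpace → z i = 1 → v ∈ A.rowSpace → v i = 0 →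
      eval v f ≠ 0 → 3 * polar f (MvPolynomial (Fin 6) ℂ) (C ∘ v) X X ∈ I ∧
    ∃ q : Fin 2 → MvPolynomial (Fin 6) ℂ, ∀ c₁ c₂ : MvPolynomial (Fin 2) ℂ, IsRelPrime c₁ c₂ →
      c₁ ≠ 0 → aeval q c₁ ∈ I → aeval q c₂ ∈ I →
      ∃ r, algebraMap (ChartRing f A.toGrass i) _ r = b := by
    intro z v hz hzi hvW hvi hv
    obtain ⟨B, hBA, -, rfl, hB⟩ := A.exists_frame_of_mem hz hvW hzi hvi (hne hv)
    exact B.exists_numerators hBA hf hB hv hb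
  have hZ : zeroLocus ℂ I ⊆
      {z | z ∈ A.rowSpace ∧ z i = 1 ∧ ∀ w ∈ A.rowSpace, polar f ℂ z z w = 0} := by
    intro z hz
    have hz' : ∀ p ∈ I, eval z p = 0 := fun p hp => hz p hp
    have hzJ : ∀ p ∈ sectionIdeal f A.toGrass, eval z p = 0 := fun p hp =>
      hz' p (hJI (Ideal.mem_sup_left hp))
    have hzW : z ∈ A.rowSpace := Frame.mem_rowSpace_iff.2 fun a ha => by
      rw [← eval_linearForm]
      exact hzJ _ (Ideal.subset_span (Set.mem_insert_of_mem _ ⟨a, ha, rfl⟩))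
    have hzi : z i = 1 := by
      have := hz' (X i - 1) (hJI (Ideal.mem_sup_right (Ideal.subset_span rfl)))
      rwa [map_sub, eval_X, map_one, sub_eq_zero] at this
    have hzf : polar f ℂ z z z = 0 := by
      rw [polar_self_eval hf, hzJ f (Ideal.subset_span (Set.mem_insert _ _)), mul_zero]
    have hpol : ∀ v ∈ A.rowSpace ⊓ LinearMap.ker (LinearMap.proj i : (Fin 6 → ℂ) →ₗ[ℂ] ℂ),
        polar f ℂ z z v = 0 := by
      refine polar_eval_self_of_forall ⟨huW, hui⟩ ?_ fun v hv hvf => ?_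
      · rw [polar_self_eval hf]
        simpa using huf
      · rw [polar_self_eval hf] at hvf
        have h1 := hz' _ (hframe hzW hzi hv.1 hv.2 (by simpa using hvf)).1
        have h2 : eval z (polar f (MvPolynomial (Fin 6) ℂ) (C ∘ v) X X) = polar f ℂ v z z := by
          refine (map_polar f (aeval (R := ℂ) z) _ _ _).trans ?_
          rw [show aeval (R := ℂ) z ∘ C ∘ v = v from funext fun j => by simp,
            show aeval (R := ℂ) z ∘ X = z from funext fun j => by simp]
        rw [map_mul, h2, polar_swap_left, polar_swap_right] at h1
        simpa using h1
    refine ⟨hzW, hzi, fun w hw => ?_⟩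
    have := hpol (w - w i • z) ⟨sub_mem hw (A.rowSpace.smul_mem _ hzW), by simp [hzi]⟩
    rwa [map_sub, map_smul, hzf, smul_zero, sub_zero] at this
  have hZfin := hfin.subset hZ
  obtain ⟨-, q, hq⟩ := hframe hz₀ hz₀i huW hui huf
  -- One polynomial in each plane coordinate, vanishing at the projections of all zeros of `I`.
  -- Involving different variables, their powers are coprime.
  let c : Fin 2 → MvPolynomial (Fin 2) ℂ := fun k =>
    ∏ z ∈ hZfin.toFinset, (X k - C (eval z (q k)))
  have hc : ∀ k, ∃ n : ℕ, aeval q (c k ^ n) ∈ I := fun k => by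
    have : aeval q (c k) ∈ I.radical := by
      rw [← vanishingIdeal_zeroLocus_eq_radical (K := ℂ) I]
      intro z hz
      simp only [c, map_prod, map_sub, aeval_X, algHom_C]
      refine Finset.prod_eq_zero (hZfin.mem_toFinset.2 hz) ?_
      simp
    obtain ⟨n, hn⟩ := this
    exact ⟨n, by rwa [map_pow]⟩
  obtain ⟨m, hm⟩ := hc 0
  obtain ⟨n, hn⟩ := hc 1
  refine hq _ _ (isRelPrime_prod_X_sub_C_pow zero_ne_one _ _ _ m n) ?_ hm hn
  exact pow_ne_zero _ (Finset.prod_ne_zero_iff.2 fun z _ h => by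
    have := congrArg (eval fun _ => eval z (q 0) + 1) h
    simp at this)

theorem Frame.exists_line_of_not_normal (A : Frame) {f : MvPolynomial (Fin 6) ℂ}
    (hf : f.IsHomogeneous 3) (hI : IsIntegralSection f A.toGrass)
    (hN : ¬ IsNormalSection f A.toGrass) :
    ∃ u ∈ A.rowSpace, ∃ v ∈ A.rowSpace, LinearIndependent ℂ ![u, v] ∧ ∀ w ∈ A.rowSpace,
      polar f ℂ u u w = 0 ∧ polar f ℂ u v w = 0 ∧ polar f ℂ v v w = 0 := by
  -- The zero form also generates a prime ideal. In that case the trilinear form vanishes on the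
  -- whole row space, and any line in the 3-space serves.
  by_cases h0 : A.restrict f = 0
  · rw [A.restrict_eq_zero_iff] at h0
    have hcube : ∀ z ∈ A.rowSpace, polar f ℂ z z z = 0 := fun z hz => by
      rw [polar_self_eval hf, h0 z hz, mul_zero]
    have hsq : ∀ z ∈ A.rowSpace, ∀ w ∈ A.rowSpace, polar f ℂ w z z = 0 := fun z hz w hw => by
      have h1 := hcube _ (add_mem hz (A.rowSpace.smul_mem 1 hw))
      have h2 := hcube _ (add_mem hz (A.rowSpace.smul_mem (-1) hw))
      rw [polar_cube_add_smul, hcube z hz, hcube w hw] at h1 h2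
      linear_combination h1 / 6 - h2 / 6
    have hall : ∀ u ∈ A.rowSpace, ∀ v ∈ A.rowSpace, ∀ w ∈ A.rowSpace, polar f ℂ u v w = 0 := by
      intro u hu v hv w hw
      have h1 := hsq (u + v) (add_mem hu hv) w hw
      simp only [map_add, LinearMap.add_apply, hsq u hu w hw, hsq v hv w hw] at h1
      rw [polar_swap_right f w v u, polar_swap_left f w u v, polar_swap_right f u w v] at h1
      linear_combination h1 / 2
    have hmem : ∀ r, A.1 r ∈ A.rowSpace := fun r => Submodule.subset_span ⟨r, rfl⟩
    refine ⟨A.1 0, hmem 0, A.1 1, hmem 1, ?_, fun w hw => ⟨hall _ (hmem 0) _ (hmem 0) _ hw,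
      hall _ (hmem 0) _ (hmem 1) _ hw, hall _ (hmem 1) _ (hmem 1) _ hw⟩⟩
    have := A.linearIndependent.comp ![0, 1] (by decide)
    convert this using 1
    ext k
    fin_cases k <;> rfl
  · obtain ⟨i, hi, hR⟩ := exists_chart_not_isIntegrallyClosed hf hI hN
    exact A.exists_line_of_infinite hf hI h0 i
      (A.infinite_singular_of_not_isIntegrallyClosed hf hI h0 hi hR)

theorem topologicalKrullDim_nonNormal_le {f : MvPolynomial (Fin 6) ℂ} (hf : IsSmoothCubic f) :
    topologicalKrullDim (closure {N : Grass | IsIntegralSection f N ∧ ¬ IsNormalSection f N}) ≤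
      4 := by
  refine topologicalKrullDim_line_le hf _ fun A hA => ?_
  obtain ⟨u, hu, v, hv, huv, h⟩ := A.exists_line_of_not_normal hf.homogeneous hA.1 hA.2
  obtain ⟨a, rfl⟩ := Frame.mem_rowSpace.1 hu
  obtain ⟨b, rfl⟩ := Frame.mem_rowSpace.1 hv
  refine ⟨a, b, ?_, fun i => h _ (Submodule.subset_span ⟨i, rfl⟩)⟩
  refine LinearIndependent.pair_iff.2 fun s t hst => LinearIndependent.pair_iff.1 huv s t ?_
  simp only [Finset.smul_sum, smul_smul, ← Finset.sum_add_distrib, ← add_smul]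
  refine Finset.sum_eq_zero fun r _ => ?_
  have := congrFun hst r
  simp only [Pi.add_apply, Pi.smul_apply, smul_eq_mul, Pi.zero_apply] at this
  rw [this, zero_smul]

end CubicFourfold

theorem mainTheorem12 (f : MvPolynomial (Fin 6) ℂ) (hf : CubicFourfold.IsSmoothCubic f) :
    topologicalKrullDim (closure {N : CubicFourfold.Grass |
      CubicFourfold.IsIntegralSection f N ∧ ¬ CubicFourfold.IsNormalSection f N}) ≤ 4 ∧
    (¬ CubicFourfold.ContainsPlane f →
      topologicalKrullDim (closure {N : CubicFourfold.Grass |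
        CubicFourfold.IsSimpleEllipticSection f N}) ≤ 4) :=
  ⟨CubicFourfold.topologicalKrullDim_nonNormal_le hf,
    fun _ => CubicFourfold.topologicalKrullDim_simpleElliptic_le hf⟩
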